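/- **Setting.** Let $W_1,W_2,\dots$ be i.i.d. random elements of a measurable space $\mathcal W$ (e.g. a subset of $\mathbf R^{d_w}$) with law $F_0$, defined on a probability space, and let $X_i=\pi(W_i)\in\mathcal X$, where $\pi$ is a measurable map (e.g. $X_i$ is a sub-vector of $W_i$). $W$ denotes a generic observation and $X=\pi(W)$. Let $\mathcal T\subseteq\mathbf R^p$ be convex with non-empty interior, let $\eta_0:\mathcal X\to\mathcal T$ be measurable, $\eta_i=\eta_0(X_i)$, and $m(W,\theta,\eta)=\psi^b(W,\eta)-\psi^a(W,\eta)\,\theta$ with $\psi^a,\psi^b:\mathcal W\times\mathcal T\to\mathbf R$ measurable. The parameter $\theta_0\in\mathbf R$ satisfies $E[m(W,\theta_0,\eta_0(X))]=0$. **Estimator.** For each $n$ let $1\le K=K_n\le n$ (for $n\ge1$). The indices $\{1,\dots,n\}$ are split, independently of the data (by a random split of any law, or a fixed one), into $K$ folds $\mathcal I_1,\dots,\mathcal I_K$, each of size $\lfloor n/K\rfloor$ or $\lfloor n/K\rfloor+1$ (all of size $n/K$ if $K$ divides $n$). For each $k$, $\hat\eta_k:\mathcal X\to\mathcal T$ is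 computed, by a measurable procedure, from $\{W_i:i\notin\mathcal I_k\}$ only. Put $\hat\eta_i=\hat\eta_k(X_i)$ for $i\in\mathcal I_k$ and $$\hat\theta_{n,2}=\frac{n^{-1}\sum_{i=1}^n\psi^b(W_i,\hat\eta_i)}{n^{-1}\sum_{i=1}^n\psi^a(W_i,\hat\eta_i)} .$$ **Assumption 1 (moment function).** There are finite constants $M,C_0,C_1,C_2,C_3$ with $C_0>0$ such that $|E[\psi^a(W,\eta_0(X))]|>C_0$ and, for $z=a,b$: $\psi^z(w,\cdot)$ is three times continuously differentiable on $\mathcal T$ for every $w$; $E[\partial_\eta\psi^z(W,\eta_0(X))\mid X]=0$ a.s.; $E[\psi^z(W,\eta_0(X))^4]<M$ and $E[\|\partial_\eta\psi^z(W,\eta_0(X))\|^4]<M$; all entries of $E[\partial_\eta\psi^z(W,\eta_0(X))\,\partial_\eta\psi^z(W,\eta_0(X))^\top\mid X]$ are bounded by $C_1$ in absolute value a.s.; and, a.s., for all $\eta\in\mathcal T$ all second-order (third-order) partial derivatives of $\psi^z(W,\cdot)$ at $\eta$ are bounded by $C_2$ (by $C_3$) in absolute value. **Assumption 2 (nuisance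 estimators).** There are real numbers $\varphi_1,\varphi_2$, finite constants $M_1$, $C_\delta>0$, $C_b>0$, a sequence $\tau_n>0$ with $\tau_n\to0$, and measurable functions $\delta_{n_0}:\mathcal W\times\mathcal X\to\mathbf R^p$, $b_{n_0}:\mathcal X\times\mathcal X\to\mathbf R^p$ ($n_0\in\mathbf N$) such that the following holds. (a) For all $n$, $k\le K$ and $x\in\mathcal X$, with $n_0=n-|\mathcal I_k|$ the number of observations used by $\hat\eta_k$ (so $n_0=\frac{K-1}{K}n$ if $K$ divides $n$), if $n_0\geq 1$, $$\hat\eta_k(x)-\eta_0(x)=n_0^{-1/2}\sum_{\ell\notin\mathcal I_k}n_0^{-\varphi_1}\delta_{n_0}(W_\ell,x)+n_0^{-1}\sum_{\ell\notin\mathcal I_k}n_0^{-\varphi_2}b_{n_0}(X_\ell,x)+n_0^{-2\min\{\varphi_1,\varphi_2\}}\hat R_k(x),$$ where $\hat R_k(x)=O_p(1)$ for any fixed $x$ and $k$. For all sufficiently large $n_0$ and every $x\in\mathcal X$, $\delta_{n_0}(W,x)$ is integrable, $E[\delta_{n_0}(W,x)\mid X]=0$ a.s. and $E[\|\delta_{n_0}(W,x)\|^2]>C_\delta$.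 (b) For all sufficiently large $n_0$ and $i\ne j$: - $E\big[E[\|\delta_{n_0}(W_j,X_i)\|^2\mid X_i]^2\big]\le M_1$ and $E\big[E[\|n_0^{-\varphi_2}b_{n_0}(X_j,X_i)\|^2\mid X_i]^2\big]\le n_0^{2(1-2\varphi_1)}\tau_{n_0}$; - $E[\|\delta_{n_0}(W_j,X_i)\|^{2s}]<n_0^{(s-1)(1-2\varphi_1)}M_1$ for $s=1,2$; - $C_b<E\big[\|E[b_{n_0}(X_j,X_i)\mid X_i]\|^4\big]<M_1$; - $E[\|n_0^{-\varphi_2}b_{n_0}(X_j,X_i)\|^{2s}]<n_0^{(2s-1)(1-2\varphi_1)}\tau_{n_0}$ for $s=1,2$. (c) With $\hat R_i=\hat R_k(X_i)$ for $i\in\mathcal I_k$: $\max_{i\le n}E[\|\hat R_i\|^2]=O(1)$ as $n\to\infty$. (d) $n^{-1}\sum_{i=1}^n\|\hat R_i\|^4=O_p(n^{4\min\{\varphi_1,\varphi_2\}})$. **Theorem.** Suppose Assumptions 1 and 2 hold, $K\le n$, and $K\to\infty$ as $n\to\infty$ (at any rate; $K=n$, leave-one-out, is allowed). If $\varphi_1\le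 1/2$ and $1/4<\min\{\varphi_1,\varphi_2\}$, then $$\sqrt n\,(\hat\theta_{n,2}-\theta_0)\xrightarrow{d}N(0,\sigma^2),\qquad \sigma^2=\frac{E[m(W,\theta_0,\eta_0(X))^2]}{E[\psi^a(W,\eta_0(X))]^2}.$$ -/

import Mathlib

open MeasureTheory ProbabilityTheory Filter Topology

namespace DML

/-- `Y n = O_p(r n)` under `P`. -/
def IsBigOp {Ω : Type*} [MeasurableSpace Ω] (P : Measure Ω) (Y : ℕ → Ω → ℝ) (r : ℕ → ℝ) : Prop :=
  ∀ ε : ℝ, 0 < ε → ∃ B : ℝ, ∀ᶠ n in atTop, P {ω | B * r n < |Y n ω|} ≤ ENNReal.ofReal ε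

section Moment

variable {𝒲 𝒳 : Type*} [MeasurableSpace 𝒲] [MeasurableSpace 𝒳] {p : ℕ}

/-- The moment function `m(w, θ, η) = ψᵇ(w, η) - ψᵃ(w, η) θ`. -/
def moment (ψa ψb : 𝒲 → EuclideanSpace ℝ (Fin p) → ℝ) (w : 𝒲) (θ : ℝ)
    (η : EuclideanSpace ℝ (Fin p)) : ℝ :=
  ψb w η - ψa w η * θ

/-- The Euclidean vector `∂_η ψ(w, η₀(x))` of first partial derivatives, where `x = π w` is the
value of the covariates in the observation `w`. -/
noncomputable def gradAt (𝒯 : Set (EuclideanSpace ℝ (Fin p))) (π : 𝒲 → 𝒳)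
    (η₀ : 𝒳 → EuclideanSpace ℝ (Fin p)) (ψ : 𝒲 → EuclideanSpace ℝ (Fin p) → ℝ) (w : 𝒲) :
    EuclideanSpace ℝ (Fin p) :=
  gradientWithin (ψ w) 𝒯 (η₀ (π w))

/-- The partial derivative of order `r` of `f` at `η`, in the coordinate directions
`v 0, …, v (r - 1)`. -/
noncomputable def partialDeriv (𝒯 : Set (EuclideanSpace ℝ (Fin p))) (r : ℕ)
    (f : EuclideanSpace ℝ (Fin p) → ℝ) (η : EuclideanSpace ℝ (Fin p)) (v : Fin r → Fin p) : ℝ :=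
  iteratedFDerivWithin ℝ r f 𝒯 η (fun j => EuclideanSpace.single (v j) 1)

/-- The conditions imposed on each of the two functions `ψᵃ` and `ψᵇ`: three times continuous
differentiability in `η ∈ 𝒯`, orthogonality, moment bounds and bounds on the derivatives.
`F₀` is the law of `W`; conditioning on `X` is conditioning on the σ-algebra generated by `π`. -/
structure RegularScore (F₀ : Measure 𝒲) (π : 𝒲 → 𝒳) (𝒯 : Set (EuclideanSpace ℝ (Fin p)))
    (η₀ : 𝒳 → EuclideanSpace ℝ (Fin p)) (M C₁ C₂ C₃ : ℝ)
    (ψ : 𝒲 → EuclideanSpace ℝ (Fin p) → ℝ) : Prop where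
  measurable : Measurable (fun q : 𝒲 × 𝒯 => ψ q.1 (q.2 : EuclideanSpace ℝ (Fin p)))
  contDiffOn : ∀ w, ContDiffOn ℝ 3 (ψ w) 𝒯
  grad_aestronglyMeasurable : AEStronglyMeasurable (gradAt 𝒯 π η₀ ψ) F₀
  orthogonal : F₀[gradAt 𝒯 π η₀ ψ | MeasurableSpace.comap π inferInstance] =ᵐ[F₀] 0
  fourth_moment : ∫⁻ w, ‖ψ w (η₀ (π w))‖ₑ ^ 4 ∂F₀ < ENNReal.ofReal M
  grad_fourth_moment : ∫⁻ w, ‖gradAt 𝒯 π η₀ ψ w‖ₑ ^ 4 ∂F₀ < ENNReal.ofReal M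
  cond_grad_sq : ∀ i j : Fin p, ∀ᵐ w ∂F₀,
    |(F₀[fun w' => gradAt 𝒯 π η₀ ψ w' i * gradAt 𝒯 π η₀ ψ w' j |
        MeasurableSpace.comap π inferInstance]) w| ≤ C₁
  second_deriv : ∀ᵐ w ∂F₀, ∀ η ∈ 𝒯, ∀ v : Fin 2 → Fin p, |partialDeriv 𝒯 2 (ψ w) η v| ≤ C₂
  third_deriv : ∀ᵐ w ∂F₀, ∀ η ∈ 𝒯, ∀ v : Fin 3 → Fin p, |partialDeriv 𝒯 3 (ψ w) η v| ≤ C₃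

/-- The assumption on the moment function. -/
structure MomentAssumption (F₀ : Measure 𝒲) (π : 𝒲 → 𝒳) (𝒯 : Set (EuclideanSpace ℝ (Fin p)))
    (η₀ : 𝒳 → EuclideanSpace ℝ (Fin p)) (M C₀ C₁ C₂ C₃ : ℝ)
    (ψa ψb : 𝒲 → EuclideanSpace ℝ (Fin p) → ℝ) : Prop where
  C₀_pos : 0 < C₀
  identification : C₀ < |∫ w, ψa w (η₀ (π w)) ∂F₀|
  regular_a : RegularScore F₀ π 𝒯 η₀ M C₁ C₂ C₃ ψa
  regular_b : RegularScore F₀ π 𝒯 η₀ M C₁ C₂ C₃ ψb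

end Moment

section CrossFitting

variable {Ω 𝒲 𝒳 : Type*} [MeasurableSpace Ω] [MeasurableSpace 𝒲] [MeasurableSpace 𝒳] {p : ℕ}

/-- A random split of the indices of the first `n` observations into `K` folds of (nearly) equal
size, drawn independently of the data: `fold ω i = k` means `i ∈ 𝓘_k`. No law is prescribed for the
split (a uniform draw and a fixed partition are both covered). -/
structure IsRandomSplit (P : Measure Ω) (W : ℕ → Ω → 𝒲) (n K : ℕ)
    (fold : Ω → Fin n → Fin K) : Prop where
  measurable : Measurable fold
  indep : IndepFun fold (fun ω (i : ℕ) => W i ω) P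
  balanced : ∀ ω k, (Finset.univ.filter (fun i => fold ω i = k)).card = n / K ∨
    (Finset.univ.filter (fun i => fold ω i = k)).card = n / K + 1

/-- The indices outside the fold `k`. -/
def train {n K : ℕ} (f : Fin n → Fin K) (k : Fin K) : Finset (Fin n) :=
  Finset.univ.filter (fun i => f i ≠ k)

/-- A procedure that estimates a function `𝒳 → ℝᵖ` from the observations with indices in `S`, for
every `S ⊆ {0, …, n-1}`. -/
abbrev Learner (𝒲 𝒳 : Type*) (p n : ℕ) :=
  (S : Finset (Fin n)) → (S → 𝒲) → 𝒳 → EuclideanSpace ℝ (Fin p)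

/-- `η̂_k(x)`: the procedure applied to the observations outside the fold `k`. -/
def etaHat {n K : ℕ} (W : ℕ → Ω → 𝒲) (fold : Ω → Fin n → Fin K) (L : Learner 𝒲 𝒳 p n)
    (k : Fin K) (ω : Ω) (x : 𝒳) : EuclideanSpace ℝ (Fin p) :=
  L (train (fold ω) k) (fun i => W (i : Fin n) ω) x

/-- `η̂_i = η̂_k(X_i)` for `i ∈ 𝓘_k`. -/
def etaHatObs {n K : ℕ} (W : ℕ → Ω → 𝒲) (π : 𝒲 → 𝒳) (fold : Ω → Fin n → Fin K)
    (L : Learner 𝒲 𝒳 p n) (i : Fin n) (ω : Ω) : EuclideanSpace ℝ (Fin p) :=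
  etaHat W fold L (fold ω i) ω (π (W i ω))

/-- The DML2 estimator. -/
noncomputable def thetaDML2 {n K : ℕ} (W : ℕ → Ω → 𝒲) (π : 𝒲 → 𝒳) (fold : Ω → Fin n → Fin K)
    (L : Learner 𝒲 𝒳 p n) (ψa ψb : 𝒲 → EuclideanSpace ℝ (Fin p) → ℝ) (ω : Ω) : ℝ :=
  ((n : ℝ)⁻¹ * ∑ i : Fin n, ψb (W i ω) (etaHatObs W π fold L i ω)) /
    ((n : ℝ)⁻¹ * ∑ i : Fin n, ψa (W i ω) (etaHatObs W π fold L i ω))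

/-- The assumption on the nuisance estimators, for a given sequence `K` of numbers of folds.
`n₀` is the number of observations outside a fold. For `i ≠ j` the observations `W_j` and `W_i` are
independent with law `F₀`, so `E[g(W_j, X_i) | X_i]` is `∫ g(w, X_i) dF₀(w)`, and
`E[g(W_j, X_i)]` is the corresponding double integral. -/
structure NuisanceAssumption (P : Measure Ω) (F₀ : Measure 𝒲) (W : ℕ → Ω → 𝒲) (π : 𝒲 → 𝒳)
    (η₀ : 𝒳 → EuclideanSpace ℝ (Fin p)) (K : ℕ → ℕ)
    (fold : (n : ℕ) → Ω → Fin n → Fin (K n)) (L : (n : ℕ) → Learner 𝒲 𝒳 p n)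
    (φ₁ φ₂ M₁ Cδ Cb : ℝ) (τ : ℕ → ℝ)
    (δ : ℕ → 𝒲 → 𝒳 → EuclideanSpace ℝ (Fin p)) (b : ℕ → 𝒳 → 𝒳 → EuclideanSpace ℝ (Fin p))
    (R : (n : ℕ) → Fin (K n) → Ω → 𝒳 → EuclideanSpace ℝ (Fin p)) : Prop where
  Cδ_pos : 0 < Cδ
  Cb_pos : 0 < Cb
  τ_pos : ∀ n₀, 0 < τ n₀
  τ_tendsto : Tendsto τ atTop (𝓝 0)
  δ_measurable : ∀ n₀, Measurable (fun q : 𝒲 × 𝒳 => δ n₀ q.1 q.2)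
  b_measurable : ∀ n₀, Measurable (fun q : 𝒳 × 𝒳 => b n₀ q.1 q.2)
  /-- The stochastic expansion of `η̂_k(x) - η₀(x)`. -/
  expansion : ∀ (n : ℕ) (k : Fin (K n)) (ω : Ω) (x : 𝒳) (S : Finset (Fin n)) (n₀ : ℕ),
    S = train (fold n ω) k → n₀ = S.card → 0 < n₀ →
      etaHat W (fold n) (L n) k ω x - η₀ x =
        (n₀ : ℝ) ^ (-(1 / 2) : ℝ) • ∑ l ∈ S, (n₀ : ℝ) ^ (-φ₁) • δ n₀ (W l ω) x
        + (n₀ : ℝ)⁻¹ • ∑ l ∈ S, (n₀ : ℝ) ^ (-φ₂) • b n₀ (π (W l ω)) x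
        + (n₀ : ℝ) ^ (-2 * min φ₁ φ₂) • R n k ω x
  /-- `R̂(x) = O_p(1)` for any given `x` and `k`. -/
  remainder_pointwise : ∀ (x : 𝒳) (k : ℕ),
    IsBigOp P (fun n ω => if h : k < K n then ‖R n ⟨k, h⟩ ω x‖ else 0) (fun _ => 1)
  /-- `E[δ(W_l, x) | X_l] = 0` for any given `x`. -/
  δ_centered : ∀ᶠ n₀ in atTop, ∀ x, Integrable (fun w => δ n₀ w x) F₀ ∧
    F₀[fun w => δ n₀ w x | MeasurableSpace.comap π inferInstance] =ᵐ[F₀] 0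
  δ_lower : ∀ᶠ n₀ in atTop, ∀ x, ENNReal.ofReal Cδ < ∫⁻ w, ‖δ n₀ w x‖ₑ ^ 2 ∂F₀
  δ_cond_sq : ∀ᶠ n₀ in atTop,
    ∫⁻ w', (∫⁻ w, ‖δ n₀ w (π w')‖ₑ ^ 2 ∂F₀) ^ 2 ∂F₀ ≤ ENNReal.ofReal M₁
  b_cond_sq : ∀ᶠ n₀ : ℕ in atTop,
    ∫⁻ w', (∫⁻ w, ‖(n₀ : ℝ) ^ (-φ₂) • b n₀ (π w) (π w')‖ₑ ^ 2 ∂F₀) ^ 2 ∂F₀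
      ≤ ENNReal.ofReal ((n₀ : ℝ) ^ (2 * (1 - 2 * φ₁)) * τ n₀)
  δ_moments : ∀ᶠ n₀ : ℕ in atTop, ∀ s ∈ ({1, 2} : Finset ℕ),
    ∫⁻ w', ∫⁻ w, ‖δ n₀ w (π w')‖ₑ ^ (2 * s) ∂F₀ ∂F₀
      < ENNReal.ofReal ((n₀ : ℝ) ^ (((s : ℝ) - 1) * (1 - 2 * φ₁)) * M₁)
  /-- `E[‖E[b(X_j, X_i) | X_i]‖⁴] ∈ (C_b, M₁)`. -/
  b_mean : ∀ᶠ n₀ in atTop,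
    ∫⁻ w', ‖∫ w, b n₀ (π w) (π w') ∂F₀‖ₑ ^ 4 ∂F₀
      ∈ Set.Ioo (ENNReal.ofReal Cb) (ENNReal.ofReal M₁)
  b_moments : ∀ᶠ n₀ : ℕ in atTop, ∀ s ∈ ({1, 2} : Finset ℕ),
    ∫⁻ w', ∫⁻ w, ‖(n₀ : ℝ) ^ (-φ₂) • b n₀ (π w) (π w')‖ₑ ^ (2 * s) ∂F₀ ∂F₀
      < ENNReal.ofReal ((n₀ : ℝ) ^ ((2 * (s : ℝ) - 1) * (1 - 2 * φ₁)) * τ n₀)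
  /-- `E[‖R̂(X_i)‖²] = O(1)`. -/
  remainder_sq : ∃ B : ℝ, ∀ᶠ n in atTop, ∀ i : Fin n,
    ∫⁻ ω, ‖R n (fold n ω i) ω (π (W i ω))‖ₑ ^ 2 ∂P ≤ ENNReal.ofReal B
  /-- `n⁻¹ ∑ ‖R̂(X_i)‖⁴ = O_p(n ^ (4 min(φ₁, φ₂)))`. -/
  remainder_fourth : IsBigOp P
    (fun n ω => (n : ℝ)⁻¹ * ∑ i : Fin n, ‖R n (fold n ω i) ω (π (W i ω))‖ ^ 4)
    (fun n => (n : ℝ) ^ (4 * min φ₁ φ₂))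

end CrossFitting

end DML

/-! Write `g_i` for the gradient of a score at `η₀(X_i)`. By Taylor's formula, replacing `η₀(X_i)`
by `η̂_i` changes the score by `⟨g_i, η̂_i - η_i⟩ + O(‖η̂_i - η_i‖²)`. Centering `b` given `X_i`
turns the assumed expansion into `η̂_i - η_i = A_i + c_i + ρ_i`: a sum `A_i` over the training
indices of kernels `D(W_l, X_i)` that are centered in `W_l`, a drift `c_i` depending on `X_i` only,
and a remainder. With `r = (n/2)^(-2 min(φ₁, φ₂))`, the mean squares of `A_i` and `c_i` are `O(r)`
and that of `ρ_i` is `O(r²)`.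

The sum of the `⟨g_i, A_i⟩` is a degenerate quadratic form: its terms, indexed by ordered pairs `(i,
l)`, are centered in each of their two observations, so a pair correlates only with itself and its
transpose. Its second moment is thus at most of order `n²` times that of one term
(`lintegral_degenerate_sum_sq_le`), which is `O(nr)`. The terms `⟨g_i, c_i⟩` are orthogonal to each
other. After division by `√n` both sums have second moment `O(r)`, and `r → 0` suffices. All other
terms are bounded in mean by `O(r)` each, hence by `√n r` after normalization; this is where
`min(φ₁, φ₂) > 1/4` is needed (`CrossFitExpansion.tendsto_quadraticBound`).

All sums are treated at once over the whole sample rather than fold by fold, so the rate at which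
`K` grows plays no role; only `n₀ ≥ n/2` matters. Randomness of the split is removed by freezing it
(`IsRandomSplit.lintegral_le`). The result, `CrossFitExpansion.tendsto_score_sub`, applied to `ψᵃ`
and `ψᵇ`, reduces the claim to the central limit theorem, the law of large numbers and Slutsky's
lemma. -/

namespace DML

/-! ### Integration against independent observations -/

section Independence

variable {Ω 𝒲 𝒱 : Type*} [MeasurableSpace Ω] [MeasurableSpace 𝒲] [MeasurableSpace 𝒱]
  {P : Measure Ω} [IsProbabilityMeasure P] {F₀ : Measure 𝒲} [IsProbabilityMeasure F₀]

/-- If `U` and `V` are independent and `F(·, v)` has mean zero under the law of `U`, then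
`F(U, V)` has mean zero. -/
theorem integral_eq_zero_of_indepFun {U : Ω → 𝒲} {V : Ω → 𝒱} (hU : Measurable U)
    (hV : Measurable V) (hUV : IndepFun U V P) (hlaw : P.map U = F₀) {F : 𝒲 × 𝒱 → ℝ}
    (hF : Measurable F) (h0 : ∀ᵐ ω ∂P, ∫ w, F (w, V ω) ∂F₀ = 0) :
    ∫ ω, F (U ω, V ω) ∂P = 0 := by
  have : IsProbabilityMeasure (P.map V) := Measure.isProbabilityMeasure_map hV.aemeasurable
  by_cases hi : Integrable (fun ω => F (U ω, V ω)) P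
  · have hmap : P.map (fun ω => (U ω, V ω)) = F₀.prod (P.map V) := by
      rw [hUV.map_prod_eq_prod_map_map hU.aemeasurable hV.aemeasurable, hlaw]
    have hi' : Integrable F (F₀.prod (P.map V)) := by
      rw [← hmap]
      exact (integrable_map_measure hF.aestronglyMeasurable (hU.prodMk hV).aemeasurable).2 hi
    calc ∫ ω, F (U ω, V ω) ∂P = ∫ q, F q ∂(P.map fun ω => (U ω, V ω)) :=
          (integral_map (hU.prodMk hV).aemeasurable hF.aestronglyMeasurable).symm
      _ = ∫ v, ∫ w, F (w, v) ∂F₀ ∂(P.map V) := by rw [hmap, integral_prod_symm _ hi']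
      _ = ∫ ω, ∫ w, F (w, V ω) ∂F₀ ∂P :=
          integral_map hV.aemeasurable
            (StronglyMeasurable.integral_prod_left
              (f := fun w v => F (w, v)) hF.stronglyMeasurable).aestronglyMeasurable
      _ = 0 := integral_eq_zero_of_ae h0
  -- The Bochner integral of a non-integrable function is zero, so no moment condition on `F` is
  -- required.
  · exact integral_undef hi

-- The indices `a`, `b`, `c` may coincide: this one form serves every cross moment of two kernels,
-- however their indices overlap.
omit [IsProbabilityMeasure P] in
theorem indepFun_triple {ι : Type*} {W : ι → Ω → 𝒲} (hW : ∀ i, Measurable (W i)) (hind : iIndepFun W P)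
    {i a b c : ι} (ha : i ≠ a) (hb : i ≠ b) (hc : i ≠ c) :
    IndepFun (W i) (fun ω => (W a ω, W b ω, W c ω)) P := by
  classical
  have h := hind.indepFun_finset {i} {a, b, c} (by simp [ha, hb, hc]) hW
  let f : (({i} : Finset ι) → 𝒲) → 𝒲 := fun x => x ⟨i, by simp⟩
  let g : (({a, b, c} : Finset ι) → 𝒲) → 𝒲 × 𝒲 × 𝒲 :=
    fun x => (x ⟨a, by simp⟩, x ⟨b, by simp⟩, x ⟨c, by simp⟩)
  have hf : Measurable f := measurable_pi_apply _
  have hg : Measurable g :=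
    (measurable_pi_apply _).prodMk ((measurable_pi_apply _).prodMk (measurable_pi_apply _))
  exact h.comp hf hg

theorem lintegral_pair {ι : Type*} {W : ι → Ω → 𝒲} (hW : ∀ i, Measurable (W i))
    (hlaw : ∀ i, P.map (W i) = F₀) (hind : iIndepFun W P) {i l : ι} (hil : i ≠ l)
    {h : 𝒲 × 𝒲 → ENNReal} (hh : Measurable h) :
    ∫⁻ ω, h (W l ω, W i ω) ∂P = ∫⁻ w', ∫⁻ w, h (w, w') ∂F₀ ∂F₀ := by
  rw [← lintegral_map (f := h) (g := fun ω => (W l ω, W i ω)) hh ((hW l).prodMk (hW i)),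
    (hind.indepFun hil.symm).map_prod_eq_prod_map_map (hW l).aemeasurable (hW i).aemeasurable,
    hlaw, hlaw, lintegral_prod_symm _ hh.aemeasurable]

omit [IsProbabilityMeasure P] [IsProbabilityMeasure F₀] in
theorem lintegral_single {ι : Type*} {W : ι → Ω → 𝒲} (hW : ∀ i, Measurable (W i))
    (hlaw : ∀ i, P.map (W i) = F₀) (i : ι) {h : 𝒲 → ENNReal} (hh : Measurable h) :
    ∫⁻ ω, h (W i ω) ∂P = ∫⁻ w, h w ∂F₀ := by
  rw [← hlaw i, lintegral_map hh (hW i)]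

omit [IsProbabilityMeasure P] [IsProbabilityMeasure F₀] in
theorem ae_sample {ι : Type*} {W : ι → Ω → 𝒲} (hW : ∀ i, Measurable (W i))
    (hlaw : ∀ i, P.map (W i) = F₀) (i : ι) {q : 𝒲 → Prop} (h : ∀ᵐ w ∂F₀, q w) :
    ∀ᵐ ω ∂P, q (W i ω) :=
  ae_of_ae_map (hW i).aemeasurable (by rwa [hlaw i])

end Independence

/-! ### Second moments of nearly orthogonal sums -/

section SecondMoments

variable {Ω : Type*} [MeasurableSpace Ω] {P : Measure Ω}

theorem memLp_two_of_lintegral_sq {H : Type*} [NormedAddCommGroup H] {u : Ω → H}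
    (hu : AEStronglyMeasurable u P) (h : ∫⁻ ω, ‖u ω‖ₑ ^ 2 ∂P ≠ ⊤) : MemLp u 2 P := by
  refine ⟨hu, ?_⟩
  rw [eLpNorm_lt_top_iff_lintegral_rpow_enorm_lt_top (by simp) (by simp)]
  simpa using h.lt_top

theorem lintegral_enorm_sq_eq {H : Type*} [NormedAddCommGroup H] {u : Ω → H}
    (hu : MemLp u 2 P) : ∫⁻ ω, ‖u ω‖ₑ ^ 2 ∂P = ENNReal.ofReal (∫ ω, ‖u ω‖ ^ 2 ∂P) := by
  rw [ofReal_integral_eq_lintegral_ofReal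
    ((memLp_two_iff_integrable_sq_norm hu.1).1 hu) (ae_of_all _ fun _ => by positivity)]
  refine lintegral_congr fun ω => ?_
  rw [ENNReal.ofReal_pow (norm_nonneg _), ofReal_norm]

/-- Expand the square. Row `p` of the Gram matrix has at most two nonzero entries, in columns `p`
and `σ p`, each at most `b` by the arithmetic-geometric mean inequality. For sums over pairs `σ` is
the transposition; for fully orthogonal sums it is the identity and the factor 2 is slack. -/
theorem integral_norm_sum_sq_le {ι H : Type*} [DecidableEq ι] [NormedAddCommGroup H]
    [InnerProductSpace ℝ H] (S : Finset ι) (u : ι → Ω → H) (σ : ι → ι) {b : ℝ} (hb : 0 ≤ b)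
    (hu : ∀ p ∈ S, MemLp (u p) 2 P) (hsq : ∀ p ∈ S, ∫ ω, ‖u p ω‖ ^ 2 ∂P ≤ b)
    (horth : ∀ p ∈ S, ∀ q ∈ S, q ≠ p → q ≠ σ p → ∫ ω, inner ℝ (u p ω) (u q ω) ∂P = 0) :
    ∫ ω, ‖∑ p ∈ S, u p ω‖ ^ 2 ∂P ≤ 2 * S.card * b := by
  have hintsq : ∀ p ∈ S, Integrable (fun ω => ‖u p ω‖ ^ 2) P := fun p hp =>
    (memLp_two_iff_integrable_sq_norm (hu p hp).1).1 (hu p hp)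
  have hint : ∀ p ∈ S, ∀ q ∈ S, Integrable (fun ω => inner ℝ (u p ω) (u q ω)) P := by
    intro p hp q hq
    refine Integrable.mono' ((hintsq p hp).add (hintsq q hq)) ((hu p hp).1.inner (hu q hq).1)
      (ae_of_all _ fun ω => ?_)
    have := abs_real_inner_le_norm (u p ω) (u q ω)
    simp only [Real.norm_eq_abs, Pi.add_apply]
    nlinarith [sq_nonneg (‖u p ω‖ - ‖u q ω‖), sq_nonneg (‖u p ω‖ + ‖u q ω‖)]
  have hle : ∀ p ∈ S, ∀ q ∈ S, ∫ ω, inner ℝ (u p ω) (u q ω) ∂P ≤ b := by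
    intro p hp q hq
    calc ∫ ω, inner ℝ (u p ω) (u q ω) ∂P
        ≤ ∫ ω, (‖u p ω‖ ^ 2 / 2 + ‖u q ω‖ ^ 2 / 2) ∂P := by
          refine integral_mono (hint p hp q hq)
            (((hintsq p hp).div_const 2).add ((hintsq q hq).div_const 2)) fun ω => ?_
          have := real_inner_le_norm (u p ω) (u q ω)
          simp only
          nlinarith [sq_nonneg (‖u p ω‖ - ‖u q ω‖)]
      _ = (∫ ω, ‖u p ω‖ ^ 2 ∂P) / 2 + (∫ ω, ‖u q ω‖ ^ 2 ∂P) / 2 := by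
          rw [integral_add ((hintsq p hp).div_const 2) ((hintsq q hq).div_const 2),
            integral_div, integral_div]
      _ ≤ b := by linarith [hsq p hp, hsq q hq]
  have hrow : ∀ p ∈ S, ∑ q ∈ S, ∫ ω, inner ℝ (u p ω) (u q ω) ∂P ≤ 2 * b := by
    intro p hp
    calc ∑ q ∈ S, ∫ ω, inner ℝ (u p ω) (u q ω) ∂P
        ≤ ∑ q ∈ S, if q ∈ ({p, σ p} : Finset ι) then b else 0 := by
          refine Finset.sum_le_sum fun q hq => ?_
          split_ifs with h
          · exact hle p hp q hq
          · simp only [Finset.mem_insert, Finset.mem_singleton, not_or] at h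
            exact (horth p hp q hq h.1 h.2).le
      _ = ((S.filter (· ∈ ({p, σ p} : Finset ι))).card : ℝ) * b := by
          rw [← Finset.sum_filter, Finset.sum_const, nsmul_eq_mul]
      _ ≤ 2 * b := by
          refine mul_le_mul_of_nonneg_right ?_ hb
          have h1 : (S.filter (· ∈ ({p, σ p} : Finset ι))).card
              ≤ ({p, σ p} : Finset ι).card :=
            Finset.card_le_card fun q hq => (Finset.mem_filter.1 hq).2
          exact_mod_cast h1.trans Finset.card_le_two
  have hexp : ∀ ω, ‖∑ p ∈ S, u p ω‖ ^ 2 = ∑ p ∈ S, ∑ q ∈ S, inner ℝ (u p ω) (u q ω) := by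
    intro ω
    rw [← real_inner_self_eq_norm_sq, sum_inner]
    simp_rw [inner_sum]
  calc ∫ ω, ‖∑ p ∈ S, u p ω‖ ^ 2 ∂P
      = ∑ p ∈ S, ∑ q ∈ S, ∫ ω, inner ℝ (u p ω) (u q ω) ∂P := by
        simp_rw [hexp]
        rw [integral_finsetSum _ fun p hp => integrable_finsetSum _ fun q hq => hint p hp q hq]
        exact Finset.sum_congr rfl fun p hp => integral_finsetSum _ fun q hq => hint p hp q hq
    _ ≤ ∑ p ∈ S, 2 * b := Finset.sum_le_sum hrow
    _ = 2 * S.card * b := by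
        rw [Finset.sum_const, nsmul_eq_mul]; ring

/-- A sum of square-integrable random vectors each of which is orthogonal to all the others, with
at most one exception. -/
theorem lintegral_enorm_sum_sq_le {ι H : Type*} [DecidableEq ι] [NormedAddCommGroup H]
    [InnerProductSpace ℝ H] (S : Finset ι) (u : ι → Ω → H) (σ : ι → ι) (B : ENNReal)
    (hu : ∀ p ∈ S, AEStronglyMeasurable (u p) P)
    (hB : ∀ p ∈ S, ∫⁻ ω, ‖u p ω‖ₑ ^ 2 ∂P ≤ B)
    (horth : ∀ p ∈ S, ∀ q ∈ S, q ≠ p → q ≠ σ p → ∫ ω, inner ℝ (u p ω) (u q ω) ∂P = 0) :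
    ∫⁻ ω, ‖∑ p ∈ S, u p ω‖ₑ ^ 2 ∂P ≤ 2 * (S.card : ENNReal) * B := by
  rcases S.eq_empty_or_nonempty with hS | hS
  · subst hS; simp
  rcases eq_or_ne B ⊤ with hBt | hBt
  · have : (2 * (S.card : ENNReal)) ≠ 0 := by simp [hS.ne_empty]
    rw [hBt, ENNReal.mul_top this]
    exact le_top
  have hL : ∀ p ∈ S, MemLp (u p) 2 P := fun p hp =>
    memLp_two_of_lintegral_sq (hu p hp) ((hB p hp).trans_lt hBt.lt_top).ne
  have hsq : ∀ p ∈ S, ∫ ω, ‖u p ω‖ ^ 2 ∂P ≤ B.toReal := fun p hp => by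
    have := hB p hp
    rw [lintegral_enorm_sq_eq (hL p hp)] at this
    exact (ENNReal.ofReal_le_iff_le_toReal hBt).1 this
  have key := integral_norm_sum_sq_le S u σ ENNReal.toReal_nonneg hL hsq horth
  have hsum : MemLp (fun ω => ∑ p ∈ S, u p ω) 2 P := memLp_finsetSum S hL
  rw [lintegral_enorm_sq_eq hsum]
  refine (ENNReal.ofReal_le_ofReal key).trans_eq ?_
  rw [ENNReal.ofReal_mul (by positivity), ENNReal.ofReal_mul (by positivity),
    ENNReal.ofReal_toReal hBt, ENNReal.ofReal_natCast, ENNReal.ofReal_ofNat]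

end SecondMoments

/-! ### Degenerate kernels and conditionally centered scores -/

section Kernels

variable {Ω 𝒲 𝒳 ι : Type*} [MeasurableSpace Ω] [MeasurableSpace 𝒲] [MeasurableSpace 𝒳] {p : ℕ}

/-- A kernel `D(w, x)` with `E[D(W, x)] = 0` and `E‖D(W, X')‖² ≤ β` for an independent copy
`X'` of `X = π(W)`. -/
structure CenteredKernel (F₀ : Measure 𝒲) (π : 𝒲 → 𝒳) (D : 𝒲 → 𝒳 → EuclideanSpace ℝ (Fin p))
    (β : ENNReal) : Prop where
  measurable : Measurable (fun q : 𝒲 × 𝒳 => D q.1 q.2)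
  centered : ∀ᵐ w' ∂F₀, Integrable (fun w => D w (π w')) F₀ ∧ ∫ w, D w (π w') ∂F₀ = 0
  sq_le : ∫⁻ w', ∫⁻ w, ‖D w (π w')‖ₑ ^ 2 ∂F₀ ∂F₀ ≤ β

/-- A random vector `g(W)` with conditional mean zero given `X = π(W)` and conditional second
moment bounded by `κ`. -/
structure ConditionalScore (F₀ : Measure 𝒲) (π : 𝒲 → 𝒳) (g : 𝒲 → EuclideanSpace ℝ (Fin p))
    (κ : ENNReal) : Prop where
  measurable : Measurable g
  integrable : Integrable g F₀
  condExp_eq_zero : F₀[g | MeasurableSpace.comap π inferInstance] =ᵐ[F₀] 0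
  sq_mul_le : ∀ h : 𝒳 → ENNReal, Measurable h →
    ∫⁻ w, ‖g w‖ₑ ^ 2 * h (π w) ∂F₀ ≤ κ * ∫⁻ w, h (π w) ∂F₀

variable {F₀ : Measure 𝒲} [IsProbabilityMeasure F₀] {π : 𝒲 → 𝒳}
  {g : 𝒲 → EuclideanSpace ℝ (Fin p)} {κ β γ : ENNReal}

/-- A function of `X` can be pulled out of the conditional expectation given `X`; in the
non-integrable case the integral is zero by convention. -/
theorem ConditionalScore.integral_inner_eq_zero (hg : ConditionalScore F₀ π g κ)
    (hπ : Measurable π) {v : 𝒳 → EuclideanSpace ℝ (Fin p)} (hv : Measurable v) :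
    ∫ w, inner ℝ (g w) (v (π w)) ∂F₀ = 0 := by
  by_cases hi : Integrable (fun w => inner ℝ (g w) (v (π w))) F₀
  · have hm : MeasurableSpace.comap π inferInstance ≤ (inferInstance : MeasurableSpace 𝒲) :=
      hπ.comap_le
    have hvm : StronglyMeasurable[MeasurableSpace.comap π inferInstance] (fun w => v (π w)) :=
      (hv.comp (comap_measurable π)).stronglyMeasurable
    have h := condExp_bilin_of_stronglyMeasurable_right (μ := F₀)
      (innerSL ℝ (E := EuclideanSpace ℝ (Fin p))) hvm (f := g) hi hg.integrable
    rw [← integral_condExp hm]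
    refine integral_eq_zero_of_ae ?_
    filter_upwards [h, hg.condExp_eq_zero] with w h1 h2
    have h1' : (F₀[fun w => inner ℝ (g w) (v (π w)) | MeasurableSpace.comap π inferInstance]) w
      = _ := h1
    rw [h1', h2]
    simp
  · exact integral_undef hi

theorem enorm_inner_sq_le {H : Type*} [NormedAddCommGroup H] [InnerProductSpace ℝ H] (x y : H) :
    ‖inner ℝ x y‖ₑ ^ 2 ≤ ‖x‖ₑ ^ 2 * ‖y‖ₑ ^ 2 := by
  rw [← mul_pow]
  gcongr
  rw [← ofReal_norm, ← ofReal_norm, ← ofReal_norm, ← ENNReal.ofReal_mul (norm_nonneg _)]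
  exact ENNReal.ofReal_le_ofReal (norm_inner_le_norm x y)

omit [IsProbabilityMeasure F₀] in
theorem ConditionalScore.lintegral_inner_sq_le (hg : ConditionalScore F₀ π g κ)
    {v : 𝒳 → EuclideanSpace ℝ (Fin p)} (hv : Measurable v) :
    ∫⁻ w, ‖inner ℝ (g w) (v (π w))‖ₑ ^ 2 ∂F₀ ≤ κ * ∫⁻ w, ‖v (π w)‖ₑ ^ 2 ∂F₀ :=
  (lintegral_mono fun _ => enorm_inner_sq_le _ _).trans
    (hg.sq_mul_le (fun x => ‖v x‖ₑ ^ 2) (by fun_prop))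

omit [IsProbabilityMeasure F₀] in
theorem CenteredKernel.measurable_comp {D : 𝒲 → 𝒳 → EuclideanSpace ℝ (Fin p)}
    (hD : CenteredKernel F₀ π D β) {α : Type*} [MeasurableSpace α] {s : α → 𝒲} {t : α → 𝒳}
    (hs : Measurable s) (ht : Measurable t) : Measurable (fun a => D (s a) (t a)) :=
  hD.measurable.comp (hs.prodMk ht)

/-- After exchanging the integrals, the argument `w` of `D` is frozen, so that `D w (π w')` is a
function of the covariate of `w'` and the conditional second-moment bound on `g` applies. -/
theorem CenteredKernel.lintegral_inner_sq_le {D : 𝒲 → 𝒳 → EuclideanSpace ℝ (Fin p)}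
    (hD : CenteredKernel F₀ π D β) (hg : ConditionalScore F₀ π g κ) (hπ : Measurable π) :
    ∫⁻ w', ∫⁻ w, ‖inner ℝ (g w') (D w (π w'))‖ₑ ^ 2 ∂F₀ ∂F₀ ≤ κ * β := by
  have hDm := hD.measurable_comp (s := fun q : 𝒲 × 𝒲 => q.2) (t := fun q : 𝒲 × 𝒲 => π q.1)
    measurable_snd (hπ.comp measurable_fst)
  have hgm := hg.measurable
  have hm : Measurable (fun q : 𝒲 × 𝒲 => ‖inner ℝ (g q.1) (D q.2 (π q.1))‖ₑ ^ 2) :=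
    (((hgm.comp measurable_fst).inner hDm).enorm).pow_const 2
  have hm2 : Measurable (fun q : 𝒲 × 𝒲 => ‖D q.2 (π q.1)‖ₑ ^ 2) := hDm.enorm.pow_const 2
  rw [lintegral_lintegral_swap hm.aemeasurable]
  calc ∫⁻ w, ∫⁻ w', ‖inner ℝ (g w') (D w (π w'))‖ₑ ^ 2 ∂F₀ ∂F₀
      ≤ ∫⁻ w, κ * ∫⁻ w', ‖D w (π w')‖ₑ ^ 2 ∂F₀ ∂F₀ :=
        lintegral_mono fun w => hg.lintegral_inner_sq_le
          (hD.measurable_comp measurable_const measurable_id)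
    _ = κ * ∫⁻ w, ∫⁻ w', ‖D w (π w')‖ₑ ^ 2 ∂F₀ ∂F₀ :=
        lintegral_const_mul _ hm2.lintegral_prod_left'
    _ ≤ κ * β := by
        gcongr
        rw [← lintegral_lintegral_swap (f := fun w' w => ‖D w (π w')‖ₑ ^ 2) hm2.aemeasurable]
        exact hD.sq_le

variable {P : Measure Ω} [IsProbabilityMeasure P] {W : ι → Ω → 𝒲}

/-- Given `W_i`, the summands are independent and centered, because `i` is outside `S`; cross terms
vanish by integrating over `W_l` alone. -/
theorem lintegral_centered_sum_sq_le (hW : ∀ i, Measurable (W i))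
    (hlaw : ∀ i, P.map (W i) = F₀) (hind : iIndepFun W P) (hπ : Measurable π)
    {D : 𝒲 → 𝒳 → EuclideanSpace ℝ (Fin p)} (hD : CenteredKernel F₀ π D β) {i : ι}
    {S : Finset ι} (hi : i ∉ S) :
    ∫⁻ ω, ‖∑ l ∈ S, D (W l ω) (π (W i ω))‖ₑ ^ 2 ∂P ≤ 2 * (S.card : ENNReal) * β := by
  classical
  have hne : ∀ l ∈ S, i ≠ l := fun l hl h => hi (h ▸ hl)
  have hDm := hD.measurable
  refine lintegral_enorm_sum_sq_le S (fun l ω => D (W l ω) (π (W i ω))) id β ?_ ?_ ?_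
  · intro l hl
    exact (hD.measurable_comp (hW l) (hπ.comp (hW i))).aestronglyMeasurable
  · intro l hl
    rw [lintegral_pair (h := fun q : 𝒲 × 𝒲 => ‖D q.1 (π q.2)‖ₑ ^ 2) hW hlaw hind (hne l hl)]
    · exact hD.sq_le
    · exact (hD.measurable_comp measurable_fst (hπ.comp measurable_snd)).enorm.pow_const 2
  · intro l hl l' hl' hll _
    have hF : Measurable (fun q : 𝒲 × 𝒲 × 𝒲 × 𝒲 =>
        inner ℝ (D q.1 (π q.2.2.1)) (D q.2.1 (π q.2.2.1))) :=
      (hD.measurable_comp (by fun_prop) (by fun_prop)).inner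
        (hD.measurable_comp (by fun_prop) (by fun_prop))
    -- `W i` is listed twice only to match the three slots of `indepFun_triple`.
    refine integral_eq_zero_of_indepFun (hW l) (V := fun ω => (W l' ω, W i ω, W i ω)) (by fun_prop)
      (indepFun_triple hW hind hll.symm (hne l hl).symm (hne l hl).symm) (hlaw l) hF ?_
    filter_upwards [ae_sample hW hlaw i hD.centered] with ω hω
    have hcomm : ∀ w, inner ℝ (D w (π (W i ω))) (D (W l' ω) (π (W i ω)))
        = inner ℝ (D (W l' ω) (π (W i ω))) (D w (π (W i ω))) := fun w => real_inner_comm _ _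
    rw [integral_congr_ae (ae_of_all _ hcomm), integral_inner hω.1, hω.2, inner_zero_right]

/-- Two ordered pairs of distinct indices that are neither equal nor transposes of each other have
different underlying sets, so the first has an index absent from the second. Integrating over that
observation alone kills the cross moment. The kernel may vary with the pair because its
normalization depends on the training size of the fold of `q.1`. -/
theorem lintegral_degenerate_sum_sq_le (hW : ∀ i, Measurable (W i))
    (hlaw : ∀ i, P.map (W i) = F₀) (hind : iIndepFun W P) (hπ : Measurable π)
    (hg : ConditionalScore F₀ π g κ) {S : Finset (ι × ι)} (hS : ∀ q ∈ S, q.1 ≠ q.2)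
    {D : ι × ι → 𝒲 → 𝒳 → EuclideanSpace ℝ (Fin p)}
    (hD : ∀ q ∈ S, CenteredKernel F₀ π (D q) β) :
    ∫⁻ ω, ‖∑ q ∈ S, inner ℝ (g (W q.1 ω)) (D q (W q.2 ω) (π (W q.1 ω)))‖ₑ ^ 2 ∂P
      ≤ 2 * (S.card : ENNReal) * (κ * β) := by
  classical
  have hgm := hg.measurable
  have hu : ∀ q ∈ S, Measurable (fun z : 𝒲 × 𝒲 => inner ℝ (g z.1) (D q z.2 (π z.1))) :=
    fun q hq => (hgm.comp measurable_fst).inner ((hD q hq).measurable_comp measurable_snd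
      (hπ.comp measurable_fst))
  refine lintegral_enorm_sum_sq_le S
    (fun q ω => inner ℝ (g (W q.1 ω)) (D q (W q.2 ω) (π (W q.1 ω)))) Prod.swap (κ * β) ?_ ?_ ?_
  · intro q hq
    exact ((hu q hq).comp ((hW q.1).prodMk (hW q.2))).aestronglyMeasurable
  · intro q hq
    rw [lintegral_pair (h := fun z : 𝒲 × 𝒲 => ‖inner ℝ (g z.2) (D q z.1 (π z.2))‖ₑ ^ 2)
      hW hlaw hind (hS q hq)]
    · exact (hD q hq).lintegral_inner_sq_le hg hπ
    · exact ((hu q hq).comp measurable_swap).enorm.pow_const 2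
  -- If the free index is `q.1`, the score is integrated given its covariate and orthogonality
  -- applies; if it is `q.2`, the kernel is integrated and its centering applies.
  · have main : ∀ q ∈ S, ∀ r ∈ S, (q.1 ≠ r.1 ∧ q.1 ≠ r.2) ∨ (q.2 ≠ r.1 ∧ q.2 ≠ r.2) →
        ∫ ω, inner ℝ (inner ℝ (g (W q.1 ω)) (D q (W q.2 ω) (π (W q.1 ω))))
          (inner ℝ (g (W r.1 ω)) (D r (W r.2 ω) (π (W r.1 ω)))) ∂P = 0 := by
      rintro q hq r hr (⟨h1, h2⟩ | ⟨h1, h2⟩)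
      · refine integral_eq_zero_of_indepFun (hW q.1) (V := fun ω => (W q.2 ω, W r.1 ω, W r.2 ω))
          (F := fun z => inner ℝ (inner ℝ (g z.1) (D q z.2.1 (π z.1)))
            (inner ℝ (g z.2.2.1) (D r z.2.2.2 (π z.2.2.1))))
          (by fun_prop) (indepFun_triple hW hind (hS q hq) h1 h2) (hlaw q.1) ?_ ?_
        · exact ((hu q hq).comp (measurable_fst.prodMk (by fun_prop))).inner
            ((hu r hr).comp (by fun_prop))
        · refine ae_of_all _ fun ω => ?_
          simp only [RCLike.inner_apply, conj_trivial]
          rw [integral_const_mul, hg.integral_inner_eq_zero hπ (v := fun x => D q (W q.2 ω) x)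
            ((hD q hq).measurable_comp measurable_const measurable_id), mul_zero]
      · refine integral_eq_zero_of_indepFun (hW q.2) (V := fun ω => (W q.1 ω, W r.1 ω, W r.2 ω))
          (F := fun z => inner ℝ (inner ℝ (g z.2.1) (D q z.1 (π z.2.1)))
            (inner ℝ (g z.2.2.1) (D r z.2.2.2 (π z.2.2.1))))
          (by fun_prop) (indepFun_triple hW hind (hS q hq).symm h1 h2) (hlaw q.2) ?_ ?_
        · exact ((hu q hq).comp (Measurable.prodMk (by fun_prop) measurable_fst)).inner
            ((hu r hr).comp (by fun_prop))
        · filter_upwards [ae_sample hW hlaw q.1 (hD q hq).centered] with ω hω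
          simp only [RCLike.inner_apply, conj_trivial]
          rw [integral_const_mul, integral_inner hω.1, hω.2, inner_zero_right, mul_zero]
    intro q hq r hr h1 h2
    refine main q hq r hr ?_
    have h3 : ¬ (r.1 = q.1 ∧ r.2 = q.2) := fun h => h1 (Prod.ext h.1 h.2)
    have h4 : ¬ (r.1 = q.2 ∧ r.2 = q.1) := fun h => h2 (Prod.ext h.1 h.2)
    have h5 := hS q hq
    have h6 := hS r hr
    grind

theorem lintegral_score_sum_sq_le (hW : ∀ i, Measurable (W i))
    (hlaw : ∀ i, P.map (W i) = F₀) (hind : iIndepFun W P) (hπ : Measurable π)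
    (hg : ConditionalScore F₀ π g κ) {S : Finset ι}
    {c : ι → 𝒳 → EuclideanSpace ℝ (Fin p)} (hc : ∀ i ∈ S, Measurable (c i))
    (hγ : ∀ i ∈ S, ∫⁻ w, ‖c i (π w)‖ₑ ^ 2 ∂F₀ ≤ γ) :
    ∫⁻ ω, ‖∑ i ∈ S, inner ℝ (g (W i ω)) (c i (π (W i ω)))‖ₑ ^ 2 ∂P
      ≤ 2 * (S.card : ENNReal) * (κ * γ) := by
  classical
  have hgm := hg.measurable
  have hu : ∀ i ∈ S, Measurable (fun w => inner ℝ (g w) (c i (π w))) :=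
    fun i hi => hgm.inner ((hc i hi).comp hπ)
  refine lintegral_enorm_sum_sq_le S
    (fun i ω => inner ℝ (g (W i ω)) (c i (π (W i ω)))) id (κ * γ) ?_ ?_ ?_
  · intro i hi
    exact ((hu i hi).comp (hW i)).aestronglyMeasurable
  · intro i hi
    rw [lintegral_single hW hlaw i ((hu i hi).enorm.pow_const 2)]
    exact (hg.lintegral_inner_sq_le (hc i hi)).trans (mul_le_mul_right (hγ i hi) _)
  · intro i hi j hj hij _
    refine integral_eq_zero_of_indepFun (hW i) (V := W j)
      (F := fun z => inner ℝ (inner ℝ (g z.1) (c i (π z.1))) (inner ℝ (g z.2) (c j (π z.2))))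
      (hW j) (hind.indepFun hij.symm) (hlaw i)
      (((hu i hi).comp measurable_fst).inner ((hu j hj).comp measurable_snd)) ?_
    refine ae_of_all _ fun ω => ?_
    simp only [RCLike.inner_apply, conj_trivial]
    rw [integral_const_mul, hg.integral_inner_eq_zero hπ (hc i hi), mul_zero]

end Kernels

/-! ### Second-order Taylor bound on a convex set -/

section Taylor

variable {p : ℕ} {𝒯 : Set (EuclideanSpace ℝ (Fin p))} {f : EuclideanSpace ℝ (Fin p) → ℝ} {C : ℝ}

theorem norm_bilin_le_of_entries
    (B : EuclideanSpace ℝ (Fin p) →L[ℝ] EuclideanSpace ℝ (Fin p) →L[ℝ] ℝ)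
    (hB : ∀ i j, |B (EuclideanSpace.single i 1) (EuclideanSpace.single j 1)| ≤ C) :
    ‖B‖ ≤ (p : ℝ) ^ 2 * C := by
  -- When `p = 0` there are no entries and `C` may be negative, but then the factor `p ^ 2`
  -- vanishes.
  have hC : 0 ≤ (p : ℝ) ^ 2 * C := by
    rcases Nat.eq_zero_or_pos p with h | h
    · subst h; simp
    · have := (abs_nonneg _).trans (hB ⟨0, h⟩ ⟨0, h⟩)
      positivity
  have hdec : ∀ u : EuclideanSpace ℝ (Fin p), u = ∑ i, u i • EuclideanSpace.single i (1 : ℝ) := by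
    intro u
    conv_lhs => rw [← (EuclideanSpace.basisFun (Fin p) ℝ).sum_repr u]
    simp
  refine ContinuousLinearMap.opNorm_le_bound _ hC fun u => ?_
  refine ContinuousLinearMap.opNorm_le_bound _ (by positivity) fun v => ?_
  have h1 : B u v = ∑ i, ∑ j, u i * (v j *
      B (EuclideanSpace.single i 1) (EuclideanSpace.single j 1)) := by
    conv_lhs => rw [hdec u, hdec v]
    simp only [map_sum, map_smul, _root_.sum_apply, _root_.smul_apply,
      smul_eq_mul, Finset.mul_sum]
    rw [Finset.sum_comm]
    exact Finset.sum_congr rfl fun i _ => Finset.sum_congr rfl fun j _ => by ring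
  rw [h1]
  calc ‖∑ i, ∑ j, u i * (v j * B (EuclideanSpace.single i 1) (EuclideanSpace.single j 1))‖
      ≤ ∑ i : Fin p, ∑ j : Fin p, ‖u‖ * (‖v‖ * C) := by
        refine (norm_sum_le _ _).trans (Finset.sum_le_sum fun i _ => ?_)
        refine (norm_sum_le _ _).trans (Finset.sum_le_sum fun j _ => ?_)
        rw [norm_mul, norm_mul]
        gcongr
        · exact PiLp.norm_apply_le u i
        · exact PiLp.norm_apply_le v j
        · exact hB i j
    _ = (p : ℝ) ^ 2 * C * ‖u‖ * ‖v‖ := by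
        simp only [Finset.sum_const, Finset.card_univ, Fintype.card_fin, nsmul_eq_mul]
        ring

/-- The mean value inequality is used twice: the entry bound makes the derivative Lipschitz on `𝒯`,
and then `f` minus its linear part at `x` has small derivative along the segment from `x` to `y`.
The factor 1/2 is given up. Non-empty interior makes derivatives within `𝒯` unique, boundary points
included. -/
theorem abs_sub_sub_inner_gradientWithin_le (h𝒯 : Convex ℝ 𝒯) (hint : (interior 𝒯).Nonempty)
    (hf : ContDiffOn ℝ 3 f 𝒯)
    (h2 : ∀ η ∈ 𝒯, ∀ v : Fin 2 → Fin p, |partialDeriv 𝒯 2 f η v| ≤ C)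
    {x y : EuclideanSpace ℝ (Fin p)} (hx : x ∈ 𝒯) (hy : y ∈ 𝒯) :
    |f y - f x - inner ℝ (gradientWithin f 𝒯 x) (y - x)| ≤ (p : ℝ) ^ 2 * C * ‖y - x‖ ^ 2 := by
  have hu : UniqueDiffOn ℝ 𝒯 := uniqueDiffOn_convex h𝒯 hint
  have hd : DifferentiableOn ℝ f 𝒯 := hf.differentiableOn (by norm_num)
  have hd2 : DifferentiableOn ℝ (fderivWithin ℝ f 𝒯) 𝒯 :=
    (hf.fderivWithin hu (m := 2) (by norm_num)).differentiableOn (by norm_num)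
  have hB : ∀ z ∈ 𝒯, ‖fderivWithin ℝ (fderivWithin ℝ f 𝒯) 𝒯 z‖ ≤ (p : ℝ) ^ 2 * C := by
    intro z hz
    refine norm_bilin_le_of_entries _ fun i j => ?_
    have := h2 z hz ![i, j]
    rw [partialDeriv, iteratedFDerivWithin_two_apply f hu hz] at this
    simpa using this
  have hC : 0 ≤ (p : ℝ) ^ 2 * C := (norm_nonneg (fderivWithin ℝ (fderivWithin ℝ f 𝒯) 𝒯 x)).trans (hB x hx)
  have hseg : segment ℝ x y ⊆ 𝒯 := h𝒯.segment_subset hx hy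
  rw [inner_gradientWithin_left, ← Real.norm_eq_abs]
  -- Restricting to the segment gives `‖z - x‖ ≤ ‖y - x‖`, hence a derivative bound proportional to
  -- `‖y - x‖`.
  have := Convex.norm_image_sub_le_of_norm_hasFDerivWithin_le' (f := f)
    (f' := fderivWithin ℝ f 𝒯) (φ := fderivWithin ℝ f 𝒯 x) (s := segment ℝ x y)
    (C := (p : ℝ) ^ 2 * C * ‖y - x‖) (x := x) (y := y)
    (fun z hz => ((hd z (hseg hz)).hasFDerivWithinAt).mono hseg)
    (fun z hz => ?_) (convex_segment x y) (left_mem_segment ℝ x y) (right_mem_segment ℝ x y)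
  · refine this.trans_eq (by ring)
  · refine (h𝒯.norm_image_sub_le_of_norm_fderivWithin_le hd2 hB hx (hseg hz)).trans ?_
    gcongr
    rw [← dist_eq_norm, ← dist_eq_norm]
    have h3 := (mem_segment_iff_wbtw.1 hz).dist_add_dist
    rw [dist_comm z x, dist_comm y x]
    linarith [dist_nonneg (x := z) (y := y)]

end Taylor

/-! ### The gradient as a conditional score -/

section Score

variable {𝒲 𝒳 : Type*} [MeasurableSpace 𝒲] [MeasurableSpace 𝒳] {p : ℕ}
  {F₀ : Measure 𝒲} [IsProbabilityMeasure F₀] {π : 𝒲 → 𝒳} {𝒯 : Set (EuclideanSpace ℝ (Fin p))}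
  {η₀ : 𝒳 → EuclideanSpace ℝ (Fin p)} {M C₁ C₂ C₃ : ℝ}
  {ψ : 𝒲 → EuclideanSpace ℝ (Fin p) → ℝ}

theorem memLp_two_of_lintegral_pow_four_lt_top {H : Type*} [NormedAddCommGroup H] {u : 𝒲 → H}
    (hu : AEStronglyMeasurable u F₀) (h : ∫⁻ w, ‖u w‖ₑ ^ 4 ∂F₀ < ⊤) : MemLp u 2 F₀ := by
  have h4 : MemLp u 4 F₀ := by
    refine ⟨hu, ?_⟩
    rw [eLpNorm_lt_top_iff_lintegral_rpow_enorm_lt_top (by simp) (by simp)]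
    simpa using h
  exact h4.mono_exponent (by norm_num)

theorem RegularScore.memLp_grad (h : RegularScore F₀ π 𝒯 η₀ M C₁ C₂ C₃ ψ) :
    MemLp (gradAt 𝒯 π η₀ ψ) 2 F₀ :=
  memLp_two_of_lintegral_pow_four_lt_top h.grad_aestronglyMeasurable
    (h.grad_fourth_moment.trans ENNReal.ofReal_lt_top)

/-- A measurable version of the gradient of the score. -/
noncomputable def RegularScore.grad (h : RegularScore F₀ π 𝒯 η₀ M C₁ C₂ C₃ ψ) :
    𝒲 → EuclideanSpace ℝ (Fin p) :=
  h.grad_aestronglyMeasurable.mk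

omit [IsProbabilityMeasure F₀] in
theorem RegularScore.grad_ae_eq (h : RegularScore F₀ π 𝒯 η₀ M C₁ C₂ C₃ ψ) :
    gradAt 𝒯 π η₀ ψ =ᵐ[F₀] h.grad :=
  h.grad_aestronglyMeasurable.ae_eq_mk

theorem enorm_sq_eq_sum (x : EuclideanSpace ℝ (Fin p)) :
    ‖x‖ₑ ^ 2 = ∑ i, ENNReal.ofReal (x i * x i) := by
  rw [← ENNReal.ofReal_sum_of_nonneg fun i _ => mul_self_nonneg _, ← ofReal_norm,
    ← ENNReal.ofReal_pow (norm_nonneg _), EuclideanSpace.norm_sq_eq]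
  simp [sq]

/-- This is `E[‖g‖² | X] ≤ p C₁`, from the trace of the conditional second-moment matrix. As a
domination of measures on `𝒳` it can be integrated against any measurable function with values in
`[0, ∞]`, without integrability conditions. -/
theorem RegularScore.map_withDensity_le (h : RegularScore F₀ π 𝒯 η₀ M C₁ C₂ C₃ ψ)
    (hπ : Measurable π) :
    (F₀.withDensity fun w => ‖h.grad w‖ₑ ^ 2).map π ≤ (p * ENNReal.ofReal C₁) • F₀.map π := by
  have hgm : Measurable h.grad := h.grad_aestronglyMeasurable.stronglyMeasurable_mk.measurable
  have hm : MeasurableSpace.comap π inferInstance ≤ (inferInstance : MeasurableSpace 𝒲) :=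
    hπ.comap_le
  have hL : MemLp h.grad 2 F₀ := h.memLp_grad.ae_eq h.grad_ae_eq
  have hi : ∀ i, Integrable (fun w => h.grad w i * h.grad w i) F₀ := by
    intro i
    refine Integrable.mono' ((memLp_two_iff_integrable_sq_norm hL.1).1 hL)
      (Measurable.aestronglyMeasurable (by fun_prop)) (ae_of_all _ fun w => ?_)
    have := PiLp.norm_apply_le (h.grad w) i
    rw [norm_mul, ← sq]
    gcongr
  refine Measure.le_iff.2 fun A hA => ?_
  have hB : MeasurableSet[MeasurableSpace.comap π inferInstance] (π ⁻¹' A) := ⟨A, hA, rfl⟩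
  rw [Measure.map_apply hπ hA, withDensity_apply _ (hπ hA), Measure.smul_apply,
    Measure.map_apply hπ hA]
  simp_rw [enorm_sq_eq_sum]
  rw [lintegral_finsetSum _ fun i _ => by fun_prop]
  calc ∑ i, ∫⁻ w in π ⁻¹' A, ENNReal.ofReal (h.grad w i * h.grad w i) ∂F₀
      ≤ ∑ i : Fin p, ENNReal.ofReal C₁ * F₀ (π ⁻¹' A) := by
        refine Finset.sum_le_sum fun i _ => ?_
        rw [← ofReal_integral_eq_lintegral_ofReal (hi i).integrableOn
          (ae_of_all _ fun w => mul_self_nonneg _), ← setIntegral_condExp hm (hi i) hB]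
        have hc : F₀[fun w => h.grad w i * h.grad w i | MeasurableSpace.comap π inferInstance]
            ≤ᵐ[F₀] fun _ => C₁ := by
          have he : (fun w => gradAt 𝒯 π η₀ ψ w i * gradAt 𝒯 π η₀ ψ w i)
              =ᵐ[F₀] fun w => h.grad w i * h.grad w i := by
            filter_upwards [h.grad_ae_eq] with w hw
            rw [hw]
          filter_upwards [h.cond_grad_sq i i, condExp_congr_ae (m := MeasurableSpace.comap π
            inferInstance) he] with w h1 h2
          rw [← h2]
          exact (le_abs_self _).trans h1
        calc ENNReal.ofReal (∫ w in π ⁻¹' A, (F₀[fun w => h.grad w i * h.grad w i |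
              MeasurableSpace.comap π inferInstance]) w ∂F₀)
            ≤ ENNReal.ofReal (∫ w in π ⁻¹' A, C₁ ∂F₀) :=
              ENNReal.ofReal_le_ofReal (setIntegral_mono_ae integrable_condExp.integrableOn
                (integrable_const _).integrableOn hc)
          _ = ENNReal.ofReal C₁ * F₀ (π ⁻¹' A) := by
              rw [setIntegral_const, smul_eq_mul, mul_comm,
                ENNReal.ofReal_mul' measureReal_nonneg, ofReal_measureReal]
    _ = (p * ENNReal.ofReal C₁) • F₀ (π ⁻¹' A) := by
        simp [mul_assoc]

theorem RegularScore.conditionalScore (h : RegularScore F₀ π 𝒯 η₀ M C₁ C₂ C₃ ψ)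
    (hπ : Measurable π) : ConditionalScore F₀ π h.grad (p * ENNReal.ofReal C₁) where
  measurable := h.grad_aestronglyMeasurable.stronglyMeasurable_mk.measurable
  integrable := (h.memLp_grad.ae_eq h.grad_ae_eq).integrable (by norm_num)
  condExp_eq_zero := (condExp_congr_ae h.grad_ae_eq).symm.trans h.orthogonal
  sq_mul_le u hu := by
    have hgm : Measurable h.grad := h.grad_aestronglyMeasurable.stronglyMeasurable_mk.measurable
    have := lintegral_mono' (h.map_withDensity_le hπ) (le_refl u)
    rw [lintegral_map hu hπ, lintegral_smul_measure, lintegral_map hu hπ] at this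
    exact (lintegral_withDensity_eq_lintegral_mul F₀ (hgm.enorm.pow_const 2)
      (hu.comp hπ)).symm.le.trans this

end Score

/-! ### Criteria for convergence in probability to zero -/

section Convergence

variable {Ω : Type*} [MeasurableSpace Ω] {P : Measure Ω}

theorem tendstoInMeasure_zero_of_lintegral_le {X : ℕ → Ω → ℝ} {q : ℕ} {a : ℕ → ℝ}
    (hX : ∀ n, AEMeasurable (X n) P)
    (hle : ∀ᶠ n in atTop, ∫⁻ ω, ‖X n ω‖ₑ ^ q ∂P ≤ ENNReal.ofReal (a n))
    (ha : Tendsto a atTop (𝓝 0)) : TendstoInMeasure P X atTop (fun _ => 0) := by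
  rw [tendstoInMeasure_iff_enorm]
  intro ε hε hεt
  have hlim : Tendsto (fun n => ENNReal.ofReal (a n) / ε ^ q) atTop (𝓝 0) := by
    have h1 := ENNReal.Tendsto.div_const (ENNReal.tendsto_ofReal ha) (b := ε ^ q)
      (Or.inr (pow_ne_zero q hε.ne'))
    simpa using h1
  refine tendsto_of_tendsto_of_tendsto_of_le_of_le' tendsto_const_nhds hlim
    (Eventually.of_forall fun _ => zero_le) ?_
  filter_upwards [hle] with n hn
  calc P {ω | ε ≤ ‖X n ω - 0‖ₑ} ≤ P {ω | ε ^ q ≤ ‖X n ω‖ₑ ^ q} := by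
        refine measure_mono fun ω hω => ?_
        have : ε ≤ ‖X n ω‖ₑ := by simpa using hω
        exact pow_le_pow_left₀ zero_le this q
    _ ≤ (∫⁻ ω, ‖X n ω‖ₑ ^ q ∂P) / ε ^ q :=
        meas_ge_le_lintegral_div ((hX n).enorm.pow_const q) (pow_ne_zero q hε.ne')
          (ENNReal.pow_ne_top hεt)
    _ ≤ _ := by gcongr

theorem tendstoInMeasure_zero_of_abs_le {T X Y Z : ℕ → Ω → ℝ}
    (hle : ∀ᶠ n in atTop, ∀ᵐ ω ∂P, |T n ω| ≤ |X n ω| + |Y n ω| + |Z n ω|)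
    (hX : TendstoInMeasure P X atTop (fun _ => 0)) (hY : TendstoInMeasure P Y atTop (fun _ => 0))
    (hZ : TendstoInMeasure P Z atTop (fun _ => 0)) :
    TendstoInMeasure P T atTop (fun _ => 0) := by
  rw [tendstoInMeasure_iff_norm] at *
  intro ε hε
  have h3 : 0 < ε / 3 := by positivity
  have hlim := ((hX _ h3).add (hY _ h3)).add (hZ _ h3)
  simp only [add_zero] at hlim
  refine tendsto_of_tendsto_of_tendsto_of_le_of_le' tendsto_const_nhds hlim
    (Eventually.of_forall fun _ => zero_le) ?_
  filter_upwards [hle] with n hn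
  refine le_trans (measure_mono_ae ?_) ((measure_union_le _ _).trans
    (add_le_add (measure_union_le {ω | ε / 3 ≤ ‖X n ω - 0‖} {ω | ε / 3 ≤ ‖Y n ω - 0‖}) le_rfl))
  filter_upwards [hn] with ω hω hT
  simp only [sub_zero, Real.norm_eq_abs] at hT ⊢
  have hT' : ε ≤ |T n ω| := hT
  by_contra hcon
  have h' : ¬ ((ε / 3 ≤ |X n ω| ∨ ε / 3 ≤ |Y n ω|) ∨ ε / 3 ≤ |Z n ω|) := hcon
  push Not at h'
  linarith [h'.1.1, h'.1.2, h'.2]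

end Convergence

/-! ### Moment bounds under a random split -/

section Split

variable {Ω 𝒲 𝒳 : Type*} [MeasurableSpace Ω] [MeasurableSpace 𝒲] [MeasurableSpace 𝒳] {p : ℕ}
  {P : Measure Ω} [IsProbabilityMeasure P] {F₀ : Measure 𝒲} [IsProbabilityMeasure F₀]
  {W : ℕ → Ω → 𝒲} {π : 𝒲 → 𝒳} {n K : ℕ} {fold : Ω → Fin n → Fin K}

omit [IsProbabilityMeasure P] in
theorem IsRandomSplit.measurable_apply (hf : IsRandomSplit P W n K fold)
    (hW : ∀ i, Measurable (W i)) {α : Type*} [MeasurableSpace α]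
    {G : (Fin n → Fin K) → (ℕ → 𝒲) → α} (hG : ∀ f, Measurable (G f)) :
    Measurable (fun ω => G (fold ω) (fun i => W i ω)) :=
  (measurable_from_prod_countable_right (f := fun z : (Fin n → Fin K) × (ℕ → 𝒲) => G z.1 z.2)
    hG).comp (hf.measurable.prodMk (measurable_pi_lambda _ hW))

/-- By independence and Fubini, the split can be frozen while the data are integrated. The bound is
asked only for splits of the form `fold ω₀`, since only these are known to be balanced. -/
theorem IsRandomSplit.lintegral_le (hf : IsRandomSplit P W n K fold)
    (hW : ∀ i, Measurable (W i)) {G : (Fin n → Fin K) → (ℕ → 𝒲) → ENNReal}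
    (hG : ∀ f, Measurable (G f)) {B : ENNReal}
    (hB : ∀ ω₀, ∫⁻ ω, G (fold ω₀) (fun i => W i ω) ∂P ≤ B) :
    ∫⁻ ω, G (fold ω) (fun i => W i ω) ∂P ≤ B := by
  have hWm : Measurable (fun ω (i : ℕ) => W i ω) := measurable_pi_lambda _ hW
  have hGm : Measurable (fun z : (Fin n → Fin K) × (ℕ → 𝒲) => G z.1 z.2) :=
    measurable_from_prod_countable_right hG
  have := Measure.isProbabilityMeasure_map (μ := P) hWm.aemeasurable
  calc ∫⁻ ω, G (fold ω) (fun i => W i ω) ∂P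
      = ∫⁻ z, G z.1 z.2 ∂(P.map fun ω => (fold ω, fun i : ℕ => W i ω)) :=
        (lintegral_map hGm (hf.measurable.prodMk hWm)).symm
    _ = ∫⁻ f, ∫⁻ w, G f w ∂(P.map fun ω (i : ℕ) => W i ω) ∂(P.map fold) := by
        rw [hf.indep.map_prod_eq_prod_map_map hf.measurable.aemeasurable hWm.aemeasurable,
          lintegral_prod _ hGm.aemeasurable]
    _ = ∫⁻ ω₀, ∫⁻ ω, G (fold ω₀) (fun i => W i ω) ∂P ∂P := by
        rw [lintegral_map (measurable_of_countable _) hf.measurable]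
        exact lintegral_congr fun ω₀ => lintegral_map (hG _) hWm
    _ ≤ ∫⁻ _, B ∂P := lintegral_mono hB
    _ = B := by simp

/-- The sum `∑_{l ∉ 𝓘_k} D(W_l, X_i)` for `i ∈ 𝓘_k`, where the kernel may depend on the number of
terms. -/
def crossSum (π : 𝒲 → 𝒳) (D : ℕ → 𝒲 → 𝒳 → EuclideanSpace ℝ (Fin p)) (f : Fin n → Fin K)
    (i : Fin n) (w : ℕ → 𝒲) : EuclideanSpace ℝ (Fin p) :=
  ∑ l ∈ train f (f i), D (train f (f i)).card (w l) (π (w i))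

theorem measurable_crossSum (hπ : Measurable π) {D : ℕ → 𝒲 → 𝒳 → EuclideanSpace ℝ (Fin p)}
    (hD : ∀ N, Measurable (fun q : 𝒲 × 𝒳 => D N q.1 q.2)) (f : Fin n → Fin K) (i : Fin n) :
    Measurable (crossSum π D f i) :=
  Finset.measurable_fun_sum _ fun l _ => (hD (train f (f i)).card).comp
    (f := fun a : ℕ → 𝒲 => (a l, π (a i))) ((measurable_pi_apply _).prodMk (hπ.comp (measurable_pi_apply _)))

variable {g : 𝒲 → EuclideanSpace ℝ (Fin p)} {κ β γ : ENNReal}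
  {D : ℕ → 𝒲 → 𝒳 → EuclideanSpace ℝ (Fin p)} {c : ℕ → 𝒳 → EuclideanSpace ℝ (Fin p)}

theorem lintegral_crossSum_sq_le (hW : ∀ i, Measurable (W i)) (hlaw : ∀ i, P.map (W i) = F₀)
    (hind : iIndepFun W P) (hπ : Measurable π) (hf : IsRandomSplit P W n K fold)
    (hDm : ∀ N, Measurable (fun q : 𝒲 × 𝒳 => D N q.1 q.2))
    (hD : ∀ ω i, CenteredKernel F₀ π (D (train (fold ω) (fold ω i)).card) β) (i : Fin n) :
    ∫⁻ ω, ‖crossSum π D (fold ω) i (fun j => W j ω)‖ₑ ^ 2 ∂P ≤ 2 * (n : ENNReal) * β := by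
  refine hf.lintegral_le hW (G := fun f w => ‖crossSum π D f i w‖ₑ ^ 2)
    (fun f => (measurable_crossSum hπ hDm f i).enorm.pow_const 2) fun ω₀ => ?_
  refine (lintegral_centered_sum_sq_le (W := fun (j : Fin n) => W j) (fun j => hW j)
    (fun j => hlaw j) (hind.precomp Fin.val_injective) hπ (hD ω₀ i) (i := i)
    (S := train (fold ω₀) (fold ω₀ i)) (by simp [train])).trans ?_
  gcongr
  simpa using Finset.card_le_univ (train (fold ω₀) (fold ω₀ i))

theorem lintegral_score_crossSum_sq_le (hW : ∀ i, Measurable (W i))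
    (hlaw : ∀ i, P.map (W i) = F₀) (hind : iIndepFun W P) (hπ : Measurable π)
    (hg : ConditionalScore F₀ π g κ) (hf : IsRandomSplit P W n K fold)
    (hDm : ∀ N, Measurable (fun q : 𝒲 × 𝒳 => D N q.1 q.2))
    (hD : ∀ ω i, CenteredKernel F₀ π (D (train (fold ω) (fold ω i)).card) β) :
    ∫⁻ ω, ‖∑ i : Fin n, inner ℝ (g (W i ω)) (crossSum π D (fold ω) i (fun j => W j ω))‖ₑ ^ 2 ∂P
      ≤ 2 * ((n : ENNReal) * n) * (κ * β) := by
  have hgm := hg.measurable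
  refine hf.lintegral_le hW
    (G := fun f w => ‖∑ i : Fin n, inner ℝ (g (w i)) (crossSum π D f i w)‖ₑ ^ 2)
    (fun f => (Measurable.enorm (Finset.measurable_fun_sum _ fun i _ => Measurable.inner
      (hgm.comp (measurable_pi_apply _)) (measurable_crossSum hπ hDm f i))).pow_const 2)
    fun ω₀ => ?_
  set f := fold ω₀
  -- All pairs of an evaluation index and a training index for it. There are at most `n²` of them,
  -- whatever the number of folds.
  let S : Finset (Fin n × Fin n) := Finset.univ.filter fun q => q.2 ∈ train f (f q.1)
  have hsum : ∀ ω, ∑ i : Fin n, inner ℝ (g (W i ω)) (crossSum π D f i (fun j => W j ω))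
      = ∑ q ∈ S, inner ℝ (g (W q.1 ω)) (D (train f (f q.1)).card (W q.2 ω) (π (W q.1 ω))) := by
    intro ω
    simp_rw [crossSum, inner_sum]
    exact (Finset.sum_finset_product S Finset.univ (fun i => train f (f i))
      (by simp [S]) (f := fun q : Fin n × Fin n => inner ℝ (g (W q.1 ω))
        (D (train f (f q.1)).card (W q.2 ω) (π (W q.1 ω))))).symm
  simp_rw [hsum]
  refine (lintegral_degenerate_sum_sq_le (W := fun (j : Fin n) => W j) (fun j => hW j)
    (fun j => hlaw j) (hind.precomp Fin.val_injective) hπ hg (S := S)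
    (D := fun q => D (train f (f q.1)).card) (β := β) ?_ (fun q _ => hD ω₀ q.1)).trans ?_
  · intro q hq hql
    simp [S, train, hql] at hq
  · gcongr
    have := Finset.card_le_univ S
    rw [Fintype.card_prod, Fintype.card_fin] at this
    exact_mod_cast this

theorem lintegral_score_drift_sq_le (hW : ∀ i, Measurable (W i))
    (hlaw : ∀ i, P.map (W i) = F₀) (hind : iIndepFun W P) (hπ : Measurable π)
    (hg : ConditionalScore F₀ π g κ) (hf : IsRandomSplit P W n K fold)
    (hcm : ∀ N, Measurable (c N))
    (hc : ∀ ω i, ∫⁻ w, ‖c (train (fold ω) (fold ω i)).card (π w)‖ₑ ^ 2 ∂F₀ ≤ γ) :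
    ∫⁻ ω, ‖∑ i : Fin n, inner ℝ (g (W i ω))
      (c (train (fold ω) (fold ω i)).card (π (W i ω)))‖ₑ ^ 2 ∂P
      ≤ 2 * (n : ENNReal) * (κ * γ) := by
  have hgm := hg.measurable
  refine hf.lintegral_le hW
    (G := fun f w => ‖∑ i : Fin n, inner ℝ (g (w i)) (c (train f (f i)).card (π (w i)))‖ₑ ^ 2)
    (fun f => (Measurable.enorm (Finset.measurable_fun_sum _ fun i _ => Measurable.inner
      (hgm.comp (measurable_pi_apply _))
      ((hcm _).comp (hπ.comp (measurable_pi_apply _))))).pow_const 2) fun ω₀ => ?_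
  refine (lintegral_score_sum_sq_le (W := fun (j : Fin n) => W j) (fun j => hW j)
    (fun j => hlaw j) (hind.precomp Fin.val_injective) hπ hg (S := Finset.univ)
    (c := fun i => c (train (fold ω₀) (fold ω₀ i)).card) (γ := γ) (fun i _ => hcm _)
    (fun i _ => hc ω₀ i)).trans ?_
  simp

omit [IsProbabilityMeasure F₀] in
theorem lintegral_drift_sq_le (hW : ∀ i, Measurable (W i))
    (hlaw : ∀ i, P.map (W i) = F₀) (hπ : Measurable π) (hf : IsRandomSplit P W n K fold)
    (hcm : ∀ N, Measurable (c N))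
    (hc : ∀ ω i, ∫⁻ w, ‖c (train (fold ω) (fold ω i)).card (π w)‖ₑ ^ 2 ∂F₀ ≤ γ) (i : Fin n) :
    ∫⁻ ω, ‖c (train (fold ω) (fold ω i)).card (π (W i ω))‖ₑ ^ 2 ∂P ≤ γ := by
  refine hf.lintegral_le hW (G := fun f w => ‖c (train f (f i)).card (π (w i))‖ₑ ^ 2)
    (fun f => ((hcm _).comp (hπ.comp (measurable_pi_apply _))).enorm.pow_const 2) fun ω₀ => ?_
  rw [lintegral_single (h := fun w => ‖c (train (fold ω₀) (fold ω₀ i)).card (π w)‖ₑ ^ 2)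
    hW hlaw i (((hcm _).comp hπ).enorm.pow_const 2)]
  exact hc ω₀ i

omit [IsProbabilityMeasure P] in
theorem measurable_etaHatObs (hW : ∀ i, Measurable (W i)) (hπ : Measurable π)
    (hf : IsRandomSplit P W n K fold) {L : Learner 𝒲 𝒳 p n}
    (hL : ∀ S : Finset (Fin n), Measurable (fun d : (S → 𝒲) × 𝒳 => L S d.1 d.2)) (i : Fin n) :
    Measurable (etaHatObs W π fold L i) :=
  hf.measurable_apply hW
    (G := fun f w => L (train f (f i)) (fun j => w (j : Fin n)) (π (w i))) fun f =>
      (hL (train f (f i))).comp (Measurable.prodMk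
        (measurable_pi_lambda _ fun _ => measurable_pi_apply _)
        (hπ.comp (measurable_pi_apply _)))

end Split

/-! ### Negligibility of the nuisance estimation error -/

section Expansion

variable {Ω 𝒲 𝒳 : Type*} [MeasurableSpace Ω] [MeasurableSpace 𝒲] [MeasurableSpace 𝒳] {p : ℕ}

/-- The remainder of the expansion of `η̂_i - η_i` into a sum of centered kernels and a drift. -/
def expansionRem (W : ℕ → Ω → 𝒲) (π : 𝒲 → 𝒳) (η₀ : 𝒳 → EuclideanSpace ℝ (Fin p)) {n K : ℕ}
    (fold : Ω → Fin n → Fin K) (L : Learner 𝒲 𝒳 p n)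
    (D : ℕ → 𝒲 → 𝒳 → EuclideanSpace ℝ (Fin p)) (c : ℕ → 𝒳 → EuclideanSpace ℝ (Fin p))
    (i : Fin n) (ω : Ω) : EuclideanSpace ℝ (Fin p) :=
  etaHatObs W π fold L i ω - η₀ (π (W i ω)) - crossSum π D (fold ω) i (fun j => W j ω)
    - c (train (fold ω) (fold ω i)).card (π (W i ω))

/-- The nuisance estimators are, up to `O(r²)` in mean square, sums of centered kernels plus a
drift, both of mean square `O(r)`, where `√n r → 0`. -/
structure CrossFitExpansion (P : Measure Ω) (F₀ : Measure 𝒲) (W : ℕ → Ω → 𝒲) (π : 𝒲 → 𝒳)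
    (η₀ : 𝒳 → EuclideanSpace ℝ (Fin p)) (K : ℕ → ℕ)
    (fold : (n : ℕ) → Ω → Fin n → Fin (K n)) (L : (n : ℕ) → Learner 𝒲 𝒳 p n)
    (D : ℕ → 𝒲 → 𝒳 → EuclideanSpace ℝ (Fin p)) (c : ℕ → 𝒳 → EuclideanSpace ℝ (Fin p))
    (r : ℕ → ℝ) (B : ℝ) : Prop where
  bound_nonneg : 0 ≤ B
  rate_pos : ∀ᶠ n in atTop, 0 < r n
  rate_tendsto : Tendsto (fun n : ℕ => √(n : ℝ) * r n) atTop (𝓝 0)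
  kernel_measurable : ∀ N, Measurable (fun q : 𝒲 × 𝒳 => D N q.1 q.2)
  drift_measurable : ∀ N, Measurable (c N)
  kernel : ∀ᶠ n : ℕ in atTop, ∀ ω i, CenteredKernel F₀ π
    (D (train (fold n ω) (fold n ω i)).card) (ENNReal.ofReal (B * r n / n))
  drift : ∀ᶠ n in atTop, ∀ ω i,
    ∫⁻ w, ‖c (train (fold n ω) (fold n ω i)).card (π w)‖ₑ ^ 2 ∂F₀ ≤ ENNReal.ofReal (B * r n)
  remainder : ∀ᶠ n in atTop, ∀ i,
    ∫⁻ ω, ‖expansionRem W π η₀ (fold n) (L n) D c i ω‖ₑ ^ 2 ∂P ≤ ENNReal.ofReal (B * r n ^ 2)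

variable {P : Measure Ω} [IsProbabilityMeasure P] {F₀ : Measure 𝒲} [IsProbabilityMeasure F₀]
  {W : ℕ → Ω → 𝒲} {π : 𝒲 → 𝒳} {𝒯 : Set (EuclideanSpace ℝ (Fin p))}
  {η₀ : 𝒳 → EuclideanSpace ℝ (Fin p)} {M C₁ C₂ C₃ : ℝ}
  {ψ : 𝒲 → EuclideanSpace ℝ (Fin p) → ℝ} {K : ℕ → ℕ}
  {fold : (n : ℕ) → Ω → Fin n → Fin (K n)} {L : (n : ℕ) → Learner 𝒲 𝒳 p n}
  {D : ℕ → 𝒲 → 𝒳 → EuclideanSpace ℝ (Fin p)} {c : ℕ → 𝒳 → EuclideanSpace ℝ (Fin p)}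
  {r : ℕ → ℝ} {B : ℝ}

omit [IsProbabilityMeasure P] in
theorem measurable_crossSum_fold (hW : ∀ i, Measurable (W i)) (hπ : Measurable π) {n : ℕ}
    (hf : IsRandomSplit P W n (K n) (fold n))
    (hD : ∀ N, Measurable (fun q : 𝒲 × 𝒳 => D N q.1 q.2)) (i : Fin n) :
    Measurable (fun ω => crossSum π D (fold n ω) i (fun j => W j ω)) :=
  hf.measurable_apply hW (G := fun f w => crossSum π D f i w)
    fun f => measurable_crossSum hπ hD f i

omit [IsProbabilityMeasure P] in
theorem measurable_drift_fold (hW : ∀ i, Measurable (W i)) (hπ : Measurable π) {n : ℕ}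
    (hf : IsRandomSplit P W n (K n) (fold n)) (hc : ∀ N, Measurable (c N)) (i : Fin n) :
    Measurable (fun ω => c (train (fold n ω) (fold n ω i)).card (π (W i ω))) :=
  hf.measurable_apply hW (G := fun f w => c (train f (f i)).card (π (w i)))
    fun _ => (hc _).comp (hπ.comp (measurable_pi_apply _))

omit [IsProbabilityMeasure P] [IsProbabilityMeasure F₀] in
theorem CrossFitExpansion.rate_tendsto_zero
    (h : CrossFitExpansion P F₀ W π η₀ K fold L D c r B) : Tendsto r atTop (𝓝 0) := by
  have h1 : Tendsto (fun n : ℕ => (√(n : ℝ))⁻¹) atTop (𝓝 0) :=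
    tendsto_inv_atTop_zero.comp (Real.tendsto_sqrt_atTop.comp tendsto_natCast_atTop_atTop)
  have h2 := h1.mul h.rate_tendsto
  rw [mul_zero] at h2
  refine h2.congr' ?_
  filter_upwards [eventually_gt_atTop 0] with n hn
  have : (0 : ℝ) < √n := Real.sqrt_pos.2 (by exact_mod_cast hn)
  field_simp

omit [IsProbabilityMeasure P] in
theorem lintegral_enorm_inv_sqrt_mul_sq (Y : Ω → ℝ) (n : ℕ) :
    ∫⁻ ω, ‖(√(n : ℝ))⁻¹ * Y ω‖ₑ ^ 2 ∂P
      = ENNReal.ofReal ((n : ℝ)⁻¹) * ∫⁻ ω, ‖Y ω‖ₑ ^ 2 ∂P := by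
  simp_rw [enorm_mul, mul_pow]
  have h : ‖(√(n : ℝ))⁻¹‖ₑ ^ 2 = ENNReal.ofReal ((n : ℝ)⁻¹) := by
    rw [Real.enorm_of_nonneg (by positivity), ← ENNReal.ofReal_pow (by positivity), inv_pow,
      Real.sq_sqrt (by positivity)]
  rw [h, lintegral_const_mul' _ _ ENNReal.ofReal_ne_top]

/-- At most `n²` pairs, each of second moment at most `k B r / n`, with the factor 2 for transposes,
give `2 k B r` after division by `n`. -/
theorem CrossFitExpansion.tendsto_score_crossSum
    (h : CrossFitExpansion P F₀ W π η₀ K fold L D c r B) (hW : ∀ i, Measurable (W i))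
    (hlaw : ∀ i, P.map (W i) = F₀) (hind : iIndepFun W P) (hπ : Measurable π)
    (hfold : ∀ n, IsRandomSplit P W n (K n) (fold n))
    {g : 𝒲 → EuclideanSpace ℝ (Fin p)} {k : ℝ} (hk : 0 ≤ k)
    (hg : ConditionalScore F₀ π g (ENNReal.ofReal k)) :
    TendstoInMeasure P (fun (n : ℕ) ω => (√(n : ℝ))⁻¹ *
      ∑ i : Fin n, inner ℝ (g (W i ω)) (crossSum π D (fold n ω) i (fun j => W j ω)))
      atTop (fun _ => 0) := by
  have hgm := hg.measurable
  refine tendstoInMeasure_zero_of_lintegral_le (q := 2) (a := fun n => 2 * k * B * r n) ?_ ?_ ?_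
  · intro n
    refine (Measurable.const_mul (Finset.measurable_fun_sum _ fun i _ => ?_) _).aemeasurable
    exact (hgm.comp (hW i)).inner (measurable_crossSum_fold hW hπ (hfold n) h.kernel_measurable i)
  · filter_upwards [h.kernel, h.rate_pos, eventually_gt_atTop 0] with n hn hr hn0
    have hn' : (0 : ℝ) < n := by exact_mod_cast hn0
    have hB := h.bound_nonneg
    rw [lintegral_enorm_inv_sqrt_mul_sq]
    refine (mul_le_mul_right (lintegral_score_crossSum_sq_le hW hlaw hind hπ hg (hfold n)
      h.kernel_measurable hn) _).trans_eq ?_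
    rw [← ENNReal.ofReal_natCast, ← ENNReal.ofReal_ofNat, ← ENNReal.ofReal_mul hn'.le,
      ← ENNReal.ofReal_mul (by positivity), ← ENNReal.ofReal_mul hk,
      ← ENNReal.ofReal_mul (by positivity), ← ENNReal.ofReal_mul (by positivity)]
    congr 1
    field_simp
  · simpa using h.rate_tendsto_zero.const_mul (2 * k * B)

theorem CrossFitExpansion.tendsto_score_drift
    (h : CrossFitExpansion P F₀ W π η₀ K fold L D c r B) (hW : ∀ i, Measurable (W i))
    (hlaw : ∀ i, P.map (W i) = F₀) (hind : iIndepFun W P) (hπ : Measurable π)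
    (hfold : ∀ n, IsRandomSplit P W n (K n) (fold n))
    {g : 𝒲 → EuclideanSpace ℝ (Fin p)} {k : ℝ} (hk : 0 ≤ k)
    (hg : ConditionalScore F₀ π g (ENNReal.ofReal k)) :
    TendstoInMeasure P (fun (n : ℕ) ω => (√(n : ℝ))⁻¹ *
      ∑ i : Fin n, inner ℝ (g (W i ω)) (c (train (fold n ω) (fold n ω i)).card (π (W i ω))))
      atTop (fun _ => 0) := by
  have hgm := hg.measurable
  refine tendstoInMeasure_zero_of_lintegral_le (q := 2) (a := fun n => 2 * k * B * r n) ?_ ?_ ?_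
  · intro n
    refine (Measurable.const_mul (Finset.measurable_fun_sum _ fun i _ => ?_) _).aemeasurable
    exact (hgm.comp (hW i)).inner (measurable_drift_fold hW hπ (hfold n) h.drift_measurable i)
  · filter_upwards [h.drift, h.rate_pos, eventually_gt_atTop 0] with n hn hr hn0
    have hn' : (0 : ℝ) < n := by exact_mod_cast hn0
    have hB := h.bound_nonneg
    rw [lintegral_enorm_inv_sqrt_mul_sq]
    refine (mul_le_mul_right (lintegral_score_drift_sq_le hW hlaw hind hπ hg (hfold n)
      h.drift_measurable hn) _).trans_eq ?_
    rw [← ENNReal.ofReal_natCast, ← ENNReal.ofReal_ofNat,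
      ← ENNReal.ofReal_mul (by positivity), ← ENNReal.ofReal_mul hk,
      ← ENNReal.ofReal_mul (by positivity), ← ENNReal.ofReal_mul (by positivity)]
    congr 1
    field_simp
  · simpa using h.rate_tendsto_zero.const_mul (2 * k * B)

/-- The bound on the part of the Taylor expansion that is quadratic in `η̂_i - η_i = A + c + ρ` or
involves the remainder `ρ`. -/
noncomputable def quadraticBound (C s : ℝ) (g A c ρ : EuclideanSpace ℝ (Fin p)) : ℝ :=
  s * ‖g‖ ^ 2 + s⁻¹ * ‖ρ‖ ^ 2 + 3 * C * (‖A‖ ^ 2 + ‖c‖ ^ 2 + ‖ρ‖ ^ 2)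

theorem quadraticBound_nonneg {C s : ℝ} (hC : 0 ≤ C) (hs : 0 < s)
    (g A c ρ : EuclideanSpace ℝ (Fin p)) : 0 ≤ quadraticBound C s g A c ρ := by
  unfold quadraticBound
  positivity

/-- Nothing is known about the correlation of `ρ` with `g`, so `⟨g, ρ⟩` is split by a weighted Young
inequality. With weight `s = r` and `E‖ρ‖² = O(r²)`, both halves are `O(r)`, the order of the
quadratic terms. -/
theorem abs_le_quadraticBound {C s t : ℝ} (hC : 0 ≤ C) (hs : 0 < s)
    {g A c ρ : EuclideanSpace ℝ (Fin p)}
    (ht : |t - inner ℝ g (A + c + ρ)| ≤ C * ‖A + c + ρ‖ ^ 2) :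
    |t - (inner ℝ g A + inner ℝ g c)| ≤ quadraticBound C s g A c ρ := by
  have h1 : ‖A + c + ρ‖ ^ 2 ≤ 3 * (‖A‖ ^ 2 + ‖c‖ ^ 2 + ‖ρ‖ ^ 2) := by
    have h2 : ‖A + c + ρ‖ ≤ ‖A‖ + ‖c‖ + ‖ρ‖ := norm_add₃_le
    have h3 : ‖A + c + ρ‖ ^ 2 ≤ (‖A‖ + ‖c‖ + ‖ρ‖) ^ 2 := by gcongr
    nlinarith [sq_nonneg (‖A‖ - ‖c‖), sq_nonneg (‖A‖ - ‖ρ‖), sq_nonneg (‖c‖ - ‖ρ‖)]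
  have h4 : |inner ℝ g ρ| ≤ s * ‖g‖ ^ 2 + s⁻¹ * ‖ρ‖ ^ 2 := by
    refine (abs_real_inner_le_norm g ρ).trans ?_
    have h5 : s * ‖g‖ ^ 2 + s⁻¹ * ‖ρ‖ ^ 2 - ‖g‖ * ‖ρ‖
        = s⁻¹ * ((s * ‖g‖ - ‖ρ‖ / 2) ^ 2 + 3 / 4 * ‖ρ‖ ^ 2) := by
      field_simp
      ring
    have h6 : 0 ≤ s⁻¹ * ((s * ‖g‖ - ‖ρ‖ / 2) ^ 2 + 3 / 4 * ‖ρ‖ ^ 2) := by positivity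
    linarith
  have h7 : t - (inner ℝ g A + inner ℝ g c) = (t - inner ℝ g (A + c + ρ)) + inner ℝ g ρ := by
    rw [inner_add_right, inner_add_right]
    ring
  rw [h7]
  have h8 := mul_le_mul_of_nonneg_left h1 hC
  unfold quadraticBound
  linarith [abs_add_le (t - inner ℝ g (A + c + ρ)) (inner ℝ g ρ)]

theorem ofReal_quadraticBound {C s : ℝ} (hC : 0 ≤ C) (hs : 0 < s)
    (g A c ρ : EuclideanSpace ℝ (Fin p)) :
    ENNReal.ofReal (quadraticBound C s g A c ρ)
      = ENNReal.ofReal s * ‖g‖ₑ ^ 2 + ENNReal.ofReal s⁻¹ * ‖ρ‖ₑ ^ 2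
        + ENNReal.ofReal (3 * C) * (‖A‖ₑ ^ 2 + ‖c‖ₑ ^ 2 + ‖ρ‖ₑ ^ 2) := by
  have e : ∀ x : EuclideanSpace ℝ (Fin p), ‖x‖ₑ ^ 2 = ENNReal.ofReal (‖x‖ ^ 2) := fun x => by
    rw [← ofReal_norm, ENNReal.ofReal_pow (norm_nonneg _)]
  simp_rw [e]
  rw [← ENNReal.ofReal_mul hs.le, ← ENNReal.ofReal_mul (by positivity),
    ← ENNReal.ofReal_add (by positivity) (by positivity),
    ← ENNReal.ofReal_add (by positivity) (by positivity),
    ← ENNReal.ofReal_add (by positivity) (by positivity),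
    ← ENNReal.ofReal_mul (by positivity),
    ← ENNReal.ofReal_add (by positivity) (by positivity)]
  rfl

theorem measurable_quadraticBound {C s : ℝ} {g A c ρ : Ω → EuclideanSpace ℝ (Fin p)}
    (hg : Measurable g) (hA : Measurable A) (hc : Measurable c) (hρ : Measurable ρ) :
    Measurable (fun ω => quadraticBound C s (g ω) (A ω) (c ω) (ρ ω)) := by
  unfold quadraticBound
  fun_prop

omit [IsProbabilityMeasure P] in
theorem lintegral_quadraticBound_le {C s : ℝ} (hC : 0 ≤ C) (hs : 0 < s)
    {g A c ρ : Ω → EuclideanSpace ℝ (Fin p)}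
    (hg : Measurable g) (hA : Measurable A) (hc : Measurable c) (hρ : Measurable ρ)
    {a₁ a₂ a₃ a₄ : ℝ} (h₁ : 0 ≤ a₁) (h₂ : 0 ≤ a₂) (h₃ : 0 ≤ a₃) (h₄ : 0 ≤ a₄)
    (hg' : ∫⁻ ω, ‖g ω‖ₑ ^ 2 ∂P ≤ ENNReal.ofReal a₁)
    (hA' : ∫⁻ ω, ‖A ω‖ₑ ^ 2 ∂P ≤ ENNReal.ofReal a₂)
    (hc' : ∫⁻ ω, ‖c ω‖ₑ ^ 2 ∂P ≤ ENNReal.ofReal a₃)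
    (hρ' : ∫⁻ ω, ‖ρ ω‖ₑ ^ 2 ∂P ≤ ENNReal.ofReal a₄) :
    ∫⁻ ω, ENNReal.ofReal (quadraticBound C s (g ω) (A ω) (c ω) (ρ ω)) ∂P
      ≤ ENNReal.ofReal (s * a₁ + s⁻¹ * a₄ + 3 * C * (a₂ + a₃ + a₄)) := by
  simp_rw [ofReal_quadraticBound hC hs]
  rw [lintegral_add_left (by fun_prop), lintegral_add_left (by fun_prop),
    lintegral_const_mul _ (by fun_prop), lintegral_const_mul _ (by fun_prop),
    lintegral_const_mul _ (by fun_prop), lintegral_add_left (by fun_prop),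
    lintegral_add_left (by fun_prop), ENNReal.ofReal_add (by positivity) (by positivity),
    ENNReal.ofReal_add (by positivity) (by positivity), ENNReal.ofReal_mul hs.le,
    ENNReal.ofReal_mul (p := s⁻¹) (by positivity), ENNReal.ofReal_mul (p := 3 * C) (by positivity),
    ENNReal.ofReal_add (by positivity) (by positivity), ENNReal.ofReal_add h₂ h₃]
  gcongr

omit [MeasurableSpace Ω] [MeasurableSpace 𝒲] [MeasurableSpace 𝒳] in
/-- `η̂_i - η_i` equals the sum of the three parts of its expansion. -/
theorem crossSum_add_drift_add_rem (n : ℕ) (i : Fin n) (ω : Ω) :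
    crossSum π D (fold n ω) i (fun j => W j ω)
      + c (train (fold n ω) (fold n ω i)).card (π (W i ω))
      + expansionRem W π η₀ (fold n) (L n) D c i ω
      = etaHatObs W π (fold n) (L n) i ω - η₀ (π (W i ω)) := by
  unfold expansionRem
  abel

/-- Without cancellation a first-moment bound is all that is available: `n` terms of mean `O(r)`,
divided by `√n`. Hence the requirement `√n r → 0`. -/
theorem CrossFitExpansion.tendsto_quadraticBound
    (h : CrossFitExpansion P F₀ W π η₀ K fold L D c r B) (hW : ∀ i, Measurable (W i))
    (hlaw : ∀ i, P.map (W i) = F₀) (hind : iIndepFun W P) (hπ : Measurable π)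
    (hη₀ : Measurable η₀) (hfold : ∀ n, IsRandomSplit P W n (K n) (fold n))
    (hL : ∀ (n : ℕ) (S : Finset (Fin n)), Measurable (fun d : (S → 𝒲) × 𝒳 => L n S d.1 d.2))
    {g : 𝒲 → EuclideanSpace ℝ (Fin p)} (hgm : Measurable g) (hg : MemLp g 2 F₀) {C : ℝ}
    (hC : 0 ≤ C) :
    TendstoInMeasure P (fun (n : ℕ) ω => (√(n : ℝ))⁻¹ *
      ∑ i : Fin n, quadraticBound C (r n) (g (W i ω)) (crossSum π D (fold n ω) i (fun j => W j ω))
        (c (train (fold n ω) (fold n ω i)).card (π (W i ω)))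
        (expansionRem W π η₀ (fold n) (L n) D c i ω)) atTop (fun _ => 0) := by
  have hAm : ∀ n (i : Fin n), Measurable (fun ω => crossSum π D (fold n ω) i (fun j => W j ω)) :=
    fun n => measurable_crossSum_fold hW hπ (hfold n) h.kernel_measurable
  have hcm : ∀ n (i : Fin n),
      Measurable (fun ω => c (train (fold n ω) (fold n ω i)).card (π (W i ω))) :=
    fun n => measurable_drift_fold hW hπ (hfold n) h.drift_measurable
  have hρm : ∀ n (i : Fin n), Measurable (expansionRem W π η₀ (fold n) (L n) D c i) := fun n i =>
    (((measurable_etaHatObs hW hπ (hfold n) (hL n) i).sub (hη₀.comp (hπ.comp (hW i)))).sub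
      (hAm n i)).sub (hcm n i)
  have hQm : ∀ n (i : Fin n), Measurable (fun ω => quadraticBound C (r n) (g (W i ω))
      (crossSum π D (fold n ω) i (fun j => W j ω))
      (c (train (fold n ω) (fold n ω i)).card (π (W i ω)))
      (expansionRem W π η₀ (fold n) (L n) D c i ω)) := fun n i =>
    measurable_quadraticBound (hgm.comp (hW i)) (hAm n i) (hcm n i) (hρm n i)
  have hB := h.bound_nonneg
  set G : ℝ := ∫ w, ‖g w‖ ^ 2 ∂F₀ with hG
  have hG0 : 0 ≤ G := integral_nonneg fun _ => by positivity
  -- `G` and the first `B` come from the two halves of the Young inequality; inside the bracket,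
  -- `2B` belongs to the kernel sum, `B` to the drift and `B * r n` to the remainder.
  refine tendstoInMeasure_zero_of_lintegral_le (q := 1)
    (a := fun n => √(n : ℝ) * r n * (G + B + 3 * C * (3 * B + B * r n))) ?_ ?_ ?_
  · exact fun n => (Measurable.const_mul (Finset.measurable_fun_sum _ fun i _ => hQm n i)
      _).aemeasurable
  · filter_upwards [h.kernel, h.drift, h.remainder, h.rate_pos, eventually_gt_atTop 0]
      with n hk hd hrem hr hn0
    have hn' : (0 : ℝ) < n := by exact_mod_cast hn0
    have hbound : ∀ i : Fin n, ∫⁻ ω, ENNReal.ofReal (quadraticBound C (r n) (g (W i ω))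
        (crossSum π D (fold n ω) i (fun j => W j ω))
        (c (train (fold n ω) (fold n ω i)).card (π (W i ω)))
        (expansionRem W π η₀ (fold n) (L n) D c i ω)) ∂P
        ≤ ENNReal.ofReal (r n * G + (r n)⁻¹ * (B * r n ^ 2)
          + 3 * C * (2 * B * r n + B * r n + B * r n ^ 2)) := by
      intro i
      refine lintegral_quadraticBound_le hC hr (hgm.comp (hW i)) (hAm n i) (hcm n i) (hρm n i)
        hG0 (by positivity) (by positivity) (by positivity) ?_ ?_
        (lintegral_drift_sq_le hW hlaw hπ (hfold n) h.drift_measurable hd i) (hrem i)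
      · refine ((lintegral_single hW hlaw i (hgm.enorm.pow_const 2)).trans
          (lintegral_enorm_sq_eq hg)).le
      · refine (lintegral_crossSum_sq_le hW hlaw hind hπ (hfold n) h.kernel_measurable
          hk i).trans_eq ?_
        rw [← ENNReal.ofReal_natCast, ← ENNReal.ofReal_ofNat, ← ENNReal.ofReal_mul (by positivity),
          ← ENNReal.ofReal_mul (by positivity)]
        congr 1
        field_simp
    simp_rw [pow_one, enorm_mul]
    rw [lintegral_const_mul' _ _ enorm_ne_top]
    have hsum : ∀ ω, ‖∑ i : Fin n, quadraticBound C (r n) (g (W i ω))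
        (crossSum π D (fold n ω) i (fun j => W j ω))
        (c (train (fold n ω) (fold n ω i)).card (π (W i ω)))
        (expansionRem W π η₀ (fold n) (L n) D c i ω)‖ₑ
        = ∑ i : Fin n, ENNReal.ofReal (quadraticBound C (r n) (g (W i ω))
          (crossSum π D (fold n ω) i (fun j => W j ω))
          (c (train (fold n ω) (fold n ω i)).card (π (W i ω)))
          (expansionRem W π η₀ (fold n) (L n) D c i ω)) := fun ω => by
      rw [Real.enorm_of_nonneg (Finset.sum_nonneg fun i _ => quadraticBound_nonneg hC hr _ _ _ _),
        ENNReal.ofReal_sum_of_nonneg fun i _ => quadraticBound_nonneg hC hr _ _ _ _]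
    simp_rw [hsum]
    rw [lintegral_finsetSum _ fun i _ => (hQm n i).ennreal_ofReal]
    refine (mul_le_mul_right (Finset.sum_le_sum fun i _ => hbound i) _).trans_eq ?_
    rw [Finset.sum_const, Finset.card_univ, Fintype.card_fin, nsmul_eq_mul,
      Real.enorm_of_nonneg (by positivity), ← ENNReal.ofReal_natCast,
      ← ENNReal.ofReal_mul (by positivity), ← ENNReal.ofReal_mul (by positivity)]
    congr 1
    rw [← mul_assoc, inv_mul_eq_div, Real.div_sqrt, mul_assoc √(n : ℝ)]
    congr 1
    field_simp
    ring
  · have h1 : Tendsto (fun n => G + B + 3 * C * (3 * B + B * r n)) atTop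
        (𝓝 (G + B + 3 * C * (3 * B + B * 0))) :=
      ((h.rate_tendsto_zero.const_mul B).const_add _).const_mul _ |>.const_add _
    simpa using h.rate_tendsto.mul h1

/-- Replacing the nuisance parameter by its cross-fitted estimator has no first-order effect on
the average of an orthogonal score. -/
theorem CrossFitExpansion.tendsto_score_sub
    (h : CrossFitExpansion P F₀ W π η₀ K fold L D c r B) (hW : ∀ i, Measurable (W i))
    (hlaw : ∀ i, P.map (W i) = F₀) (hind : iIndepFun W P) (hπ : Measurable π)
    (h𝒯 : Convex ℝ 𝒯) (h𝒯_int : (interior 𝒯).Nonempty)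
    (hη₀ : Measurable η₀) (hη₀_mem : ∀ x, η₀ x ∈ 𝒯)
    (hfold : ∀ n, IsRandomSplit P W n (K n) (fold n))
    (hL : ∀ (n : ℕ) (S : Finset (Fin n)), Measurable (fun d : (S → 𝒲) × 𝒳 => L n S d.1 d.2))
    (hL_mem : ∀ n S d x, L n S d x ∈ 𝒯)
    (hψ : RegularScore F₀ π 𝒯 η₀ M C₁ C₂ C₃ ψ) :
    TendstoInMeasure P (fun (n : ℕ) ω => (√(n : ℝ))⁻¹ *
      ∑ i : Fin n, (ψ (W i ω) (etaHatObs W π (fold n) (L n) i ω) - ψ (W i ω) (η₀ (π (W i ω)))))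
      atTop (fun _ => 0) := by
  have hg := hψ.conditionalScore hπ
  have hk : (p * ENNReal.ofReal C₁ : ENNReal)
      = ENNReal.ofReal (p * ENNReal.ofReal C₁ : ENNReal).toReal :=
    (ENNReal.ofReal_toReal (ENNReal.mul_ne_top (by simp) ENNReal.ofReal_ne_top)).symm
  have hL2 : MemLp hψ.grad 2 F₀ := hψ.memLp_grad.ae_eq hψ.grad_ae_eq
  have hC : 0 ≤ (p : ℝ) ^ 2 * |C₂| := by positivity
  have hgm := hg.measurable
  rw [hk] at hg
  refine tendstoInMeasure_zero_of_abs_le ?_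
    (h.tendsto_score_crossSum hW hlaw hind hπ hfold ENNReal.toReal_nonneg hg)
    (h.tendsto_score_drift hW hlaw hind hπ hfold ENNReal.toReal_nonneg hg)
    (h.tendsto_quadraticBound hW hlaw hind hπ hη₀ hfold hL hgm hL2 hC)
  filter_upwards [h.rate_pos] with n hr
  have h1 : ∀ᵐ ω ∂P, ∀ i : Fin n, gradAt 𝒯 π η₀ ψ (W i ω) = hψ.grad (W i ω) :=
    ae_all_iff.2 fun i => ae_sample hW hlaw i hψ.grad_ae_eq
  have h2 : ∀ᵐ ω ∂P, ∀ i : Fin n, ∀ η ∈ 𝒯, ∀ v : Fin 2 → Fin p,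
      |partialDeriv 𝒯 2 (ψ (W i ω)) η v| ≤ C₂ :=
    ae_all_iff.2 fun i => ae_sample hW hlaw i hψ.second_deriv
  filter_upwards [h1, h2] with ω hω1 hω2
  have hs : 0 ≤ (√(n : ℝ))⁻¹ := by positivity
  simp only [abs_mul, abs_of_nonneg hs, ← mul_add]
  refine mul_le_mul_of_nonneg_left ?_ hs
  have hterm : ∀ i : Fin n, |(ψ (W i ω) (etaHatObs W π (fold n) (L n) i ω)
      - ψ (W i ω) (η₀ (π (W i ω))))
      - (inner ℝ (hψ.grad (W i ω)) (crossSum π D (fold n ω) i (fun j => W j ω))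
        + inner ℝ (hψ.grad (W i ω)) (c (train (fold n ω) (fold n ω i)).card (π (W i ω))))|
      ≤ quadraticBound ((p : ℝ) ^ 2 * |C₂|) (r n) (hψ.grad (W i ω))
        (crossSum π D (fold n ω) i (fun j => W j ω))
        (c (train (fold n ω) (fold n ω i)).card (π (W i ω)))
        (expansionRem W π η₀ (fold n) (L n) D c i ω) := by
    intro i
    refine abs_le_quadraticBound hC hr ?_
    rw [crossSum_add_drift_add_rem, ← hω1 i]
    exact abs_sub_sub_inner_gradientWithin_le h𝒯 h𝒯_int (hψ.contDiffOn _)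
      (fun η hη v => (hω2 i η hη v).trans (le_abs_self _)) (hη₀_mem _) (hL_mem _ _ _ _)
  have hsum := (Finset.abs_sum_le_sum_abs _ _).trans
    (Finset.sum_le_sum fun i (_ : i ∈ Finset.univ) => hterm i)
  rw [Finset.sum_sub_distrib, Finset.sum_add_distrib] at hsum
  refine le_trans ?_ (add_le_add (abs_add_le _ _) (hsum.trans (le_abs_self _)))
  refine le_trans (le_of_eq ?_) (abs_add_le _ _)
  congr 1
  ring

end Expansion

/-! ### Decomposition of the nuisance estimators -/

section Nuisance

variable {Ω 𝒲 𝒳 : Type*} [MeasurableSpace Ω] [MeasurableSpace 𝒲] [MeasurableSpace 𝒳] {p : ℕ}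

/-- The drift `n₀^{-φ₂} E[b(X, x)]` of the nuisance estimator. -/
noncomputable def driftPart (F₀ : Measure 𝒲) (π : 𝒲 → 𝒳) (φ₂ : ℝ)
    (b : ℕ → 𝒳 → 𝒳 → EuclideanSpace ℝ (Fin p)) (N : ℕ) (x : 𝒳) : EuclideanSpace ℝ (Fin p) :=
  (N : ℝ) ^ (-φ₂) • ∫ w, b N (π w) x ∂F₀

/-- The centered kernel in the expansion of the nuisance estimator. -/
noncomputable def kernelPart (F₀ : Measure 𝒲) (π : 𝒲 → 𝒳) (φ₁ φ₂ : ℝ)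
    (δ : ℕ → 𝒲 → 𝒳 → EuclideanSpace ℝ (Fin p)) (b : ℕ → 𝒳 → 𝒳 → EuclideanSpace ℝ (Fin p))
    (N : ℕ) (w : 𝒲) (x : 𝒳) : EuclideanSpace ℝ (Fin p) :=
  ((N : ℝ) ^ (-(1 / 2) : ℝ) * (N : ℝ) ^ (-φ₁)) • δ N w x
    + (N : ℝ)⁻¹ • ((N : ℝ) ^ (-φ₂) • b N (π w) x - driftPart F₀ π φ₂ b N x)

/-- With at least four folds, a fold has at most `n/4 + 1 ≤ n/2` elements once `n ≥ 4`. The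
divergence of `K` is used only through this bound. -/
theorem half_le_card_train {n K : ℕ} {f : Fin n → Fin K}
    (hf : ∀ k, (Finset.univ.filter (fun i => f i = k)).card = n / K ∨
      (Finset.univ.filter (fun i => f i = k)).card = n / K + 1) (hn : 4 ≤ n) (hK : 4 ≤ K)
    (k : Fin K) : n ≤ 2 * (train f k).card := by
  have h1 : (Finset.univ.filter (fun i => f i = k)).card + (train f k).card = n := by
    have := Finset.card_filter_add_card_filter_not (s := (Finset.univ : Finset (Fin n)))
      (fun i => f i = k)
    simpa [train] using this
  have h2 : n / K ≤ n / 4 := Nat.div_le_div_left hK (by norm_num)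
  have h3 := hf k
  omega

variable {P : Measure Ω} [IsProbabilityMeasure P] {F₀ : Measure 𝒲} [IsProbabilityMeasure F₀]
  {W : ℕ → Ω → 𝒲} {π : 𝒲 → 𝒳} {η₀ : 𝒳 → EuclideanSpace ℝ (Fin p)} {K : ℕ → ℕ}
  {fold : (n : ℕ) → Ω → Fin n → Fin (K n)} {L : (n : ℕ) → Learner 𝒲 𝒳 p n}
  {φ₁ φ₂ M₁ Cδ Cb : ℝ} {τ : ℕ → ℝ}
  {δ : ℕ → 𝒲 → 𝒳 → EuclideanSpace ℝ (Fin p)} {b : ℕ → 𝒳 → 𝒳 → EuclideanSpace ℝ (Fin p)}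
  {R : (n : ℕ) → Fin (K n) → Ω → 𝒳 → EuclideanSpace ℝ (Fin p)}

-- Translates assumptions for large `n₀` into statements for large `n`, uniformly over splits and
-- folds.
omit [IsProbabilityMeasure P] in
theorem eventually_card_train (hfold : ∀ n, IsRandomSplit P W n (K n) (fold n))
    (hK : Tendsto K atTop atTop) {q : ℕ → Prop} (hq : ∀ᶠ N in atTop, q N) :
    ∀ᶠ n in atTop, ∀ ω i, q (train (fold n ω) (fold n ω i)).card ∧
      n ≤ 2 * (train (fold n ω) (fold n ω i)).card := by
  obtain ⟨N₀, hN₀⟩ := eventually_atTop.1 hq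
  filter_upwards [hK.eventually_ge_atTop 4, eventually_ge_atTop (max 4 (2 * N₀))] with n hKn hn ω i
  have h := half_le_card_train ((hfold n).balanced ω) ((le_max_left _ _).trans hn) hKn (fold n ω i)
  exact ⟨hN₀ _ (by have := (le_max_right _ _).trans hn; omega), h⟩

omit [IsProbabilityMeasure P] in
theorem NuisanceAssumption.measurable_driftPart
    (h : NuisanceAssumption P F₀ W π η₀ K fold L φ₁ φ₂ M₁ Cδ Cb τ δ b R) (hπ : Measurable π)
    (N : ℕ) : Measurable (driftPart F₀ π φ₂ b N) := by
  have h1 : Measurable (fun q : 𝒲 × 𝒳 => b N (π q.1) q.2) :=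
    (h.b_measurable N).comp ((hπ.comp measurable_fst).prodMk measurable_snd)
  have h2 : Measurable (fun x => ∫ w, b N (π w) x ∂F₀) :=
    (StronglyMeasurable.integral_prod_left (f := fun w x => b N (π w) x)
      h1.stronglyMeasurable).measurable
  exact h2.const_smul ((N : ℝ) ^ (-φ₂))

omit [IsProbabilityMeasure P] in
theorem NuisanceAssumption.measurable_kernelPart
    (h : NuisanceAssumption P F₀ W π η₀ K fold L φ₁ φ₂ M₁ Cδ Cb τ δ b R) (hπ : Measurable π)
    (N : ℕ) : Measurable (fun q : 𝒲 × 𝒳 => kernelPart F₀ π φ₁ φ₂ δ b N q.1 q.2) := by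
  have h1 : Measurable (fun q : 𝒲 × 𝒳 => b N (π q.1) q.2) :=
    (h.b_measurable N).comp ((hπ.comp measurable_fst).prodMk measurable_snd)
  have h2 : Measurable (fun q : 𝒲 × 𝒳 => driftPart F₀ π φ₂ b N q.2) :=
    (h.measurable_driftPart hπ N).comp measurable_snd
  have h3 := h.δ_measurable N
  exact (h3.const_smul ((N : ℝ) ^ (-(1 / 2) : ℝ) * (N : ℝ) ^ (-φ₁))).add
    (((h1.const_smul ((N : ℝ) ^ (-φ₂))).sub h2).const_smul (N : ℝ)⁻¹)

theorem enorm_add_sq_le {H : Type*} [NormedAddCommGroup H] (x y : H) :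
    ‖x + y‖ₑ ^ 2 ≤ 2 * ‖x‖ₑ ^ 2 + 2 * ‖y‖ₑ ^ 2 := by
  have e : ∀ z : H, ‖z‖ₑ ^ 2 = ENNReal.ofReal (‖z‖ ^ 2) := fun z => by
    rw [← ofReal_norm, ENNReal.ofReal_pow (norm_nonneg _)]
  rw [e, e, e, ← ENNReal.ofReal_ofNat, ← ENNReal.ofReal_mul (by norm_num),
    ← ENNReal.ofReal_mul (by norm_num), ← ENNReal.ofReal_add (by positivity) (by positivity)]
  refine ENNReal.ofReal_le_ofReal ?_
  have h1 : ‖x + y‖ ^ 2 ≤ (‖x‖ + ‖y‖) ^ 2 := by gcongr; exact norm_add_le x y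
  nlinarith [sq_nonneg (‖x‖ - ‖y‖)]

theorem enorm_sub_sq_le {H : Type*} [NormedAddCommGroup H] (x y : H) :
    ‖x - y‖ₑ ^ 2 ≤ 2 * ‖x‖ₑ ^ 2 + 2 * ‖y‖ₑ ^ 2 := by
  simpa [sub_eq_add_neg] using enorm_add_sq_le x (-y)

theorem enorm_smul_sq {H : Type*} [NormedAddCommGroup H] [NormedSpace ℝ H] {a : ℝ} (ha : 0 ≤ a)
    (x : H) : ‖a • x‖ₑ ^ 2 = ENNReal.ofReal (a ^ 2) * ‖x‖ₑ ^ 2 := by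
  rw [enorm_smul, mul_pow, Real.enorm_of_nonneg ha, ENNReal.ofReal_pow ha]

theorem enorm_integral_sq_le {H : Type*} [NormedAddCommGroup H] [NormedSpace ℝ H]
    {u : 𝒲 → H} (hu : AEStronglyMeasurable u F₀) :
    ‖∫ w, u w ∂F₀‖ₑ ^ 2 ≤ ∫⁻ w, ‖u w‖ₑ ^ 2 ∂F₀ := by
  have h1 : ‖∫ w, u w ∂F₀‖ₑ ≤ eLpNorm u 2 F₀ :=
    (enorm_integral_le_lintegral_enorm u).trans
      (by rw [← eLpNorm_one_eq_lintegral_enorm]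
          exact eLpNorm_le_eLpNorm_of_exponent_le (by norm_num) hu)
  refine (pow_le_pow_left₀ zero_le h1 2).trans_eq ?_
  have := eLpNorm_nnreal_pow_eq_lintegral (f := u) (μ := F₀) (p := 2) (by norm_num)
  simpa using this

theorem integral_centered_add {H : Type*} [NormedAddCommGroup H] [NormedSpace ℝ H]
    [CompleteSpace H] {u v : 𝒲 → H} (hu : Integrable u F₀) (hu0 : ∫ w, u w ∂F₀ = 0)
    (hv : Integrable v F₀) (a e : ℝ) :
    Integrable (fun w => a • u w + e • (v w - ∫ z, v z ∂F₀)) F₀ ∧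
      ∫ w, (a • u w + e • (v w - ∫ z, v z ∂F₀)) ∂F₀ = 0 := by
  have h1 : Integrable (fun w => v w - ∫ z, v z ∂F₀) F₀ := hv.sub (integrable_const _)
  have h2 : Integrable (fun w => a • u w) F₀ := hu.smul a
  have h3 : Integrable (fun w => e • (v w - ∫ z, v z ∂F₀)) F₀ := h1.smul e
  refine ⟨h2.add h3, ?_⟩
  rw [integral_add h2 h3, integral_smul, integral_smul, hu0,
    integral_sub hv (integrable_const _)]
  simp

/-- Centering costs a factor 4, from `‖v - E v‖² ≤ 2‖v‖² + 2‖E v‖²` and Jensen's inequality. -/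
theorem lintegral_centered_add_sq_le {u v : 𝒲 → 𝒲 → EuclideanSpace ℝ (Fin p)}
    (hu : Measurable (fun q : 𝒲 × 𝒲 => u q.1 q.2)) (hv : Measurable (fun q : 𝒲 × 𝒲 => v q.1 q.2))
    {a e : ℝ} (ha : 0 ≤ a) (he : 0 ≤ e) :
    ∫⁻ w', ∫⁻ w, ‖a • u w' w + e • (v w' w - ∫ z, v w' z ∂F₀)‖ₑ ^ 2 ∂F₀ ∂F₀
      ≤ 2 * (ENNReal.ofReal (a ^ 2) * ∫⁻ w', ∫⁻ w, ‖u w' w‖ₑ ^ 2 ∂F₀ ∂F₀)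
        + 2 * (ENNReal.ofReal (e ^ 2) * (4 * ∫⁻ w', ∫⁻ w, ‖v w' w‖ₑ ^ 2 ∂F₀ ∂F₀)) := by
  have hus : Measurable (fun q : 𝒲 × 𝒲 => ‖u q.1 q.2‖ₑ ^ 2) := hu.enorm.pow_const 2
  have hvs : Measurable (fun q : 𝒲 × 𝒲 => ‖v q.1 q.2‖ₑ ^ 2) := hv.enorm.pow_const 2
  have hui : Measurable (fun w' => ∫⁻ w, ‖u w' w‖ₑ ^ 2 ∂F₀) := hus.lintegral_prod_right'
  have hvi : Measurable (fun w' => ∫⁻ w, ‖v w' w‖ₑ ^ 2 ∂F₀) := hvs.lintegral_prod_right'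
  have hin : ∀ w', ∫⁻ w, ‖a • u w' w + e • (v w' w - ∫ z, v w' z ∂F₀)‖ₑ ^ 2 ∂F₀
      ≤ 2 * (ENNReal.ofReal (a ^ 2) * ∫⁻ w, ‖u w' w‖ₑ ^ 2 ∂F₀)
        + 2 * (ENNReal.ofReal (e ^ 2) * (4 * ∫⁻ w, ‖v w' w‖ₑ ^ 2 ∂F₀)) := by
    intro w'
    have hw' : Measurable (fun w : 𝒲 => (w', w)) := measurable_prodMk_left
    have hm0 : Measurable (u w') := hu.comp hw'
    have hm3 : Measurable (v w') := hv.comp hw'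
    have hm1 : Measurable (fun w => ‖u w' w‖ₑ ^ 2) := hm0.enorm.pow_const 2
    have hm2 : Measurable (fun w => ‖v w' w‖ₑ ^ 2) := hm3.enorm.pow_const 2
    have hpt : ∀ w, ‖a • u w' w + e • (v w' w - ∫ z, v w' z ∂F₀)‖ₑ ^ 2
        ≤ 2 * (ENNReal.ofReal (a ^ 2) * ‖u w' w‖ₑ ^ 2)
          + 2 * (ENNReal.ofReal (e ^ 2)
            * (2 * ‖v w' w‖ₑ ^ 2 + 2 * ∫⁻ z, ‖v w' z‖ₑ ^ 2 ∂F₀)) := by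
      intro w
      refine (enorm_add_sq_le _ _).trans ?_
      rw [enorm_smul_sq ha, enorm_smul_sq he]
      gcongr
      refine (enorm_sub_sq_le _ _).trans ?_
      gcongr
      exact enorm_integral_sq_le hm3.aestronglyMeasurable
    refine (lintegral_mono hpt).trans_eq ?_
    rw [lintegral_add_left (by fun_prop), lintegral_const_mul _ (by fun_prop),
      lintegral_const_mul _ (by fun_prop), lintegral_const_mul _ (by fun_prop),
      lintegral_const_mul _ (by fun_prop), lintegral_add_left (by fun_prop),
      lintegral_const_mul _ (by fun_prop), lintegral_const, measure_univ, mul_one,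
      ← add_mul]
    norm_num
  refine (lintegral_mono hin).trans_eq ?_
  rw [lintegral_add_left (by fun_prop), lintegral_const_mul _ (by fun_prop),
    lintegral_const_mul _ (by fun_prop), lintegral_const_mul _ (by fun_prop),
    lintegral_const_mul _ (by fun_prop), lintegral_const_mul _ (by fun_prop)]

omit [IsProbabilityMeasure F₀] [MeasurableSpace 𝒳] in
theorem kernelPart_eq (N : ℕ) (w w' : 𝒲) :
    kernelPart F₀ π φ₁ φ₂ δ b N w (π w')
      = ((N : ℝ) ^ (-(1 / 2) : ℝ) * (N : ℝ) ^ (-φ₁)) • δ N w (π w')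
        + (N : ℝ)⁻¹ • ((N : ℝ) ^ (-φ₂) • b N (π w) (π w')
          - ∫ z, (N : ℝ) ^ (-φ₂) • b N (π z) (π w') ∂F₀) := by
  rw [kernelPart, driftPart, integral_smul]

-- The `δ` part contributes `N^(-1 - 2φ₁)` times `2|M₁|`. The fluctuation of `b` contributes `8
-- N^(-2) N^(1 - 2φ₁)`, the same order, as soon as `τ ≤ 1`. Only the case `s = 1` of the moment
-- bounds enters.
omit [IsProbabilityMeasure P] in
theorem NuisanceAssumption.eventually_centeredKernel
    (h : NuisanceAssumption P F₀ W π η₀ K fold L φ₁ φ₂ M₁ Cδ Cb τ δ b R) (hπ : Measurable π) :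
    ∀ᶠ N : ℕ in atTop, CenteredKernel F₀ π (kernelPart F₀ π φ₁ φ₂ δ b N)
      (ENNReal.ofReal ((2 * |M₁| + 8) * (N : ℝ) ^ (-1 - 2 * φ₁))) := by
  filter_upwards [h.δ_centered, h.δ_moments, h.b_moments, eventually_gt_atTop 0,
    h.τ_tendsto.eventually_le_const (by norm_num : (0 : ℝ) < 1)] with N hδ hδ2 hb2 hN hτ
  have hN' : (0 : ℝ) < N := by exact_mod_cast hN
  have hbm : Measurable (fun q : 𝒲 × 𝒲 => b N (π q.1) (π q.2)) :=
    (h.b_measurable N).comp ((hπ.comp measurable_fst).prodMk (hπ.comp measurable_snd))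
  have hδm : Measurable (fun q : 𝒲 × 𝒲 => δ N q.2 (π q.1)) :=
    (h.δ_measurable N).comp (measurable_snd.prodMk (hπ.comp measurable_fst))
  have hβm : Measurable (fun q : 𝒲 × 𝒲 => (N : ℝ) ^ (-φ₂) • b N (π q.2) (π q.1)) :=
    (hbm.comp measurable_swap).const_smul ((N : ℝ) ^ (-φ₂))
  have hδ2' : ∫⁻ w', ∫⁻ w, ‖δ N w (π w')‖ₑ ^ 2 ∂F₀ ∂F₀ ≤ ENNReal.ofReal |M₁| := by
    have := hδ2 1 (by simp)
    simp only [mul_one, Nat.cast_one, sub_self, zero_mul, Real.rpow_zero, one_mul] at this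
    exact this.le.trans (ENNReal.ofReal_le_ofReal (le_abs_self _))
  have hb2' : ∫⁻ w', ∫⁻ w, ‖(N : ℝ) ^ (-φ₂) • b N (π w) (π w')‖ₑ ^ 2 ∂F₀ ∂F₀
      ≤ ENNReal.ofReal ((N : ℝ) ^ (1 - 2 * φ₁)) := by
    have := hb2 1 (by simp)
    norm_num at this
    refine this.le.trans (ENNReal.ofReal_le_ofReal ?_)
    exact mul_le_of_le_one_right (by positivity) hτ
  refine ⟨h.measurable_kernelPart hπ N, ?_, ?_⟩
  · have hβsq : Measurable (fun q : 𝒲 × 𝒲 => ‖(N : ℝ) ^ (-φ₂) • b N (π q.2) (π q.1)‖ₑ ^ 2) :=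
      hβm.enorm.pow_const 2
    -- The double integral gives square integrability in `w` only for almost every `w'`, which is
    -- why centering of a kernel is required almost everywhere.
    have hfin : ∀ᵐ w' ∂F₀, ∫⁻ w, ‖(N : ℝ) ^ (-φ₂) • b N (π w) (π w')‖ₑ ^ 2 ∂F₀ < ⊤ :=
      ae_lt_top hβsq.lintegral_prod_right' (hb2'.trans_lt ENNReal.ofReal_lt_top).ne
    filter_upwards [hfin] with w' hw'
    have hβw : Measurable (fun w => (N : ℝ) ^ (-φ₂) • b N (π w) (π w')) :=
      hβm.comp measurable_prodMk_left
    have hβi : Integrable (fun w => (N : ℝ) ^ (-φ₂) • b N (π w) (π w')) F₀ :=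
      (memLp_two_of_lintegral_sq hβw.aestronglyMeasurable hw'.ne).integrable (by norm_num)
    have hδ0 : ∫ w, δ N w (π w') ∂F₀ = 0 := by
      rw [← integral_condExp hπ.comap_le]
      exact integral_eq_zero_of_ae (hδ (π w')).2
    simp_rw [kernelPart_eq]
    exact integral_centered_add (hδ (π w')).1 hδ0 hβi _ _
  · have ha : (0 : ℝ) ≤ (N : ℝ) ^ (-(1 / 2) : ℝ) * (N : ℝ) ^ (-φ₁) := by positivity
    simp_rw [kernelPart_eq]
    refine (lintegral_centered_add_sq_le hδm hβm ha (by positivity)).trans ?_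
    calc _ ≤ 2 * (ENNReal.ofReal (((N : ℝ) ^ (-(1 / 2) : ℝ) * (N : ℝ) ^ (-φ₁)) ^ 2)
            * ENNReal.ofReal |M₁|)
          + 2 * (ENNReal.ofReal (((N : ℝ)⁻¹) ^ 2)
            * (4 * ENNReal.ofReal ((N : ℝ) ^ (1 - 2 * φ₁)))) := by gcongr
      _ = _ := by
        rw [← ENNReal.ofReal_ofNat 2, ← ENNReal.ofReal_ofNat 4,
          ← ENNReal.ofReal_mul (by positivity), ← ENNReal.ofReal_mul (by positivity),
          ← ENNReal.ofReal_mul (by positivity), ← ENNReal.ofReal_mul (by positivity),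
          ← ENNReal.ofReal_mul (by positivity),
          ← ENNReal.ofReal_add (by positivity) (by positivity)]
        congr 1
        have e1 : ((N : ℝ) ^ (-(1 / 2) : ℝ) * (N : ℝ) ^ (-φ₁)) ^ 2 = (N : ℝ) ^ (-1 - 2 * φ₁) := by
          rw [← Real.rpow_add hN', ← Real.rpow_natCast, ← Real.rpow_mul hN'.le]
          congr 1
          push_cast
          ring
        have e2 : ((N : ℝ)⁻¹) ^ 2 * (N : ℝ) ^ (1 - 2 * φ₁) = (N : ℝ) ^ (-1 - 2 * φ₁) := by
          rw [← Real.rpow_neg_one, ← Real.rpow_natCast, ← Real.rpow_mul hN'.le,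
            ← Real.rpow_add hN']
          congr 1
          push_cast
          ring
        rw [e1]
        linear_combination 8 * e2

omit [IsProbabilityMeasure P] in
theorem NuisanceAssumption.eventually_drift
    (h : NuisanceAssumption P F₀ W π η₀ K fold L φ₁ φ₂ M₁ Cδ Cb τ δ b R) :
    ∀ᶠ N : ℕ in atTop, ∫⁻ w, ‖driftPart F₀ π φ₂ b N (π w)‖ₑ ^ 2 ∂F₀
      ≤ ENNReal.ofReal ((1 + |M₁|) * (N : ℝ) ^ (-2 * φ₂)) := by
  filter_upwards [h.b_mean, eventually_gt_atTop 0] with N hb hN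
  have hN' : (0 : ℝ) < N := by exact_mod_cast hN
  -- Passes from the fourth moment of the conditional mean of `b` to its second moment; this is the
  -- origin of `1 + |M₁|`.
  have hpt : ∀ t : ENNReal, t ^ 2 ≤ 1 + t ^ 4 := by
    intro t
    rcases le_total t 1 with ht | ht
    · exact (pow_le_one₀ zero_le ht).trans le_self_add
    · exact (pow_le_pow_right₀ ht (by norm_num)).trans le_add_self
  calc ∫⁻ w, ‖driftPart F₀ π φ₂ b N (π w)‖ₑ ^ 2 ∂F₀
      = ENNReal.ofReal (((N : ℝ) ^ (-φ₂)) ^ 2)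
        * ∫⁻ w', ‖∫ w, b N (π w) (π w') ∂F₀‖ₑ ^ 2 ∂F₀ := by
        rw [← lintegral_const_mul' _ _ ENNReal.ofReal_ne_top]
        exact lintegral_congr fun w => enorm_smul_sq (by positivity) _
    _ ≤ ENNReal.ofReal (((N : ℝ) ^ (-φ₂)) ^ 2) * (1 + ENNReal.ofReal |M₁|) := by
        gcongr
        refine (lintegral_mono fun w' => hpt _).trans ?_
        rw [lintegral_add_left measurable_const, lintegral_const, measure_univ, mul_one]
        gcongr
        exact hb.2.le.trans (ENNReal.ofReal_le_ofReal (le_abs_self _))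
    _ = _ := by
        rw [← ENNReal.ofReal_one, ← ENNReal.ofReal_add (by positivity) (by positivity),
          ← ENNReal.ofReal_mul (by positivity), mul_comm, ← Real.rpow_natCast,
          ← Real.rpow_mul hN'.le]
        congr 3
        push_cast
        ring

-- Averaging over the training indices subtracts the drift from the `b` sum exactly once, so adding
-- it back leaves only the `R` term. Positivity of the training size is what makes `N⁻¹ * N = 1`.
omit [IsProbabilityMeasure P] [IsProbabilityMeasure F₀] in
theorem NuisanceAssumption.expansionRem_eq
    (h : NuisanceAssumption P F₀ W π η₀ K fold L φ₁ φ₂ M₁ Cδ Cb τ δ b R) {n : ℕ} (ω : Ω)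
    (i : Fin n) (hN : 0 < (train (fold n ω) (fold n ω i)).card) :
    expansionRem W π η₀ (fold n) (L n) (kernelPart F₀ π φ₁ φ₂ δ b) (driftPart F₀ π φ₂ b) i ω
      = ((train (fold n ω) (fold n ω i)).card : ℝ) ^ (-2 * min φ₁ φ₂)
        • R n (fold n ω i) ω (π (W i ω)) := by
  have hexp := h.expansion n (fold n ω i) ω (π (W i ω)) _ _ rfl rfl hN
  set S := train (fold n ω) (fold n ω i)
  have hN' : ((S.card : ℕ) : ℝ) ≠ 0 := by exact_mod_cast hN.ne'
  have hsum : crossSum π (kernelPart F₀ π φ₁ φ₂ δ b) (fold n ω) i (fun j => W j ω)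
      = (S.card : ℝ) ^ (-(1 / 2) : ℝ) • ∑ l ∈ S, (S.card : ℝ) ^ (-φ₁) • δ S.card (W l ω) (π (W i ω))
        + (S.card : ℝ)⁻¹ • ∑ l ∈ S, (S.card : ℝ) ^ (-φ₂) • b S.card (π (W l ω)) (π (W i ω))
        - driftPart F₀ π φ₂ b S.card (π (W i ω)) := by
    simp only [crossSum, kernelPart]
    rw [Finset.sum_add_distrib, ← Finset.smul_sum, ← Finset.smul_sum, Finset.sum_sub_distrib, Finset.sum_const,
      smul_sub, ← Nat.cast_smul_eq_nsmul ℝ, inv_smul_smul₀ hN', add_sub_assoc]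
    simp only [Finset.smul_sum, smul_smul, S]
  rw [expansionRem, hsum, etaHatObs, hexp]
  abel

end Nuisance

/-! ### Rates in terms of the sample size -/

section Rates

variable {Ω 𝒲 𝒳 : Type*} [MeasurableSpace Ω] [MeasurableSpace 𝒲] [MeasurableSpace 𝒳] {p : ℕ}
  {P : Measure Ω} [IsProbabilityMeasure P] {F₀ : Measure 𝒲} [IsProbabilityMeasure F₀]
  {W : ℕ → Ω → 𝒲} {π : 𝒲 → 𝒳} {η₀ : 𝒳 → EuclideanSpace ℝ (Fin p)} {K : ℕ → ℕ}
  {fold : (n : ℕ) → Ω → Fin n → Fin (K n)} {L : (n : ℕ) → Learner 𝒲 𝒳 p n}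
  {φ₁ φ₂ M₁ Cδ Cb : ℝ} {τ : ℕ → ℝ}
  {δ : ℕ → 𝒲 → 𝒳 → EuclideanSpace ℝ (Fin p)} {b : ℕ → 𝒳 → 𝒳 → EuclideanSpace ℝ (Fin p)}
  {R : (n : ℕ) → Fin (K n) → Ω → 𝒳 → EuclideanSpace ℝ (Fin p)}

theorem rpow_neg_le_of_le {n N : ℕ} (hn : 0 < n) (hN : n ≤ 2 * N) {s t : ℝ} (ht : 0 ≤ t)
    (hts : t ≤ s) : (N : ℝ) ^ (-s) ≤ ((n : ℝ) / 2) ^ (-t) := by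
  have hn' : (0 : ℝ) < n := by exact_mod_cast hn
  have hN1 : (1 : ℝ) ≤ N := by exact_mod_cast (by omega : 1 ≤ N)
  have hle : (n : ℝ) / 2 ≤ N := by
    have : (n : ℝ) ≤ 2 * N := by exact_mod_cast hN
    linarith
  exact (Real.rpow_le_rpow_of_exponent_le hN1 (neg_le_neg hts)).trans
    (Real.rpow_le_rpow_of_nonpos (by positivity) hle (neg_nonpos.2 ht))

theorem tendsto_sqrt_mul_rpow {t : ℝ} (ht : 1 / 2 < t) :
    Tendsto (fun n : ℕ => √(n : ℝ) * ((n : ℝ) / 2) ^ (-t)) atTop (𝓝 0) := by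
  have h1 : Tendsto (fun n : ℕ => (n : ℝ) ^ (-(t - 1 / 2))) atTop (𝓝 0) :=
    (tendsto_rpow_neg_atTop (by linarith)).comp tendsto_natCast_atTop_atTop
  have h2 := h1.mul_const ((2 : ℝ) ^ t)
  rw [zero_mul] at h2
  refine h2.congr' ?_
  filter_upwards [eventually_gt_atTop 0] with n hn
  have hn' : (0 : ℝ) < n := by exact_mod_cast hn
  rw [Real.div_rpow hn'.le (by norm_num), Real.rpow_neg (by norm_num : (0 : ℝ) ≤ 2), div_inv_eq_mul,
    Real.sqrt_eq_rpow, ← mul_assoc, ← Real.rpow_add hn']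
  congr 2
  ring

omit [IsProbabilityMeasure P] in
/-- Under the assumption on the nuisance estimators, the cross-fitted estimators have the required
expansion with rate `r = (n / 2)^{-2 min(φ₁, φ₂)}`. -/
theorem NuisanceAssumption.exists_crossFitExpansion
    (h : NuisanceAssumption P F₀ W π η₀ K fold L φ₁ φ₂ M₁ Cδ Cb τ δ b R) (hπ : Measurable π)
    (hfold : ∀ n, IsRandomSplit P W n (K n) (fold n)) (hK : Tendsto K atTop atTop)
    (hφ : 1 / 4 < min φ₁ φ₂) :
    ∃ B, CrossFitExpansion P F₀ W π η₀ K fold L (kernelPart F₀ π φ₁ φ₂ δ b)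
      (driftPart F₀ π φ₂ b) (fun n => ((n : ℝ) / 2) ^ (-(2 * min φ₁ φ₂))) B := by
  obtain ⟨B₀, hB₀⟩ := h.remainder_sq
  have hm1 : min φ₁ φ₂ ≤ φ₁ := min_le_left _ _
  have hm2 : min φ₁ φ₂ ≤ φ₂ := min_le_right _ _
  set m := min φ₁ φ₂ with hm
  -- The three summands serve the kernel, the drift and the remainder; the outer 2 comes from `(n /
  -- 2)⁻¹ = 2 / n`.
  refine ⟨2 * (2 * |M₁| + 8) + (1 + |M₁|) + |B₀|, ?_⟩
  refine ⟨by positivity, ?_, tendsto_sqrt_mul_rpow (by linarith), h.measurable_kernelPart hπ,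
    h.measurable_driftPart hπ, ?_, ?_, ?_⟩
  · filter_upwards [eventually_gt_atTop 0] with n hn
    have hn' : (0 : ℝ) < n := by exact_mod_cast hn
    positivity
  · filter_upwards [eventually_card_train hfold hK (h.eventually_centeredKernel hπ),
      eventually_gt_atTop 0] with n hn hn0 ω i
    have hn' : (0 : ℝ) < n := by exact_mod_cast hn0
    obtain ⟨hk, hN⟩ := hn ω i
    refine ⟨hk.measurable, hk.centered, hk.sq_le.trans (ENNReal.ofReal_le_ofReal ?_)⟩
    -- Weakening `φ₁` to the minimum leaves the exponent `-1 - 2m`, whose `-1` supplies the `1 / n`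
    -- in the kernel bound.
    have h1 := rpow_neg_le_of_le hn0 hN (s := 1 + 2 * φ₁) (t := 1 + 2 * m) (by linarith)
      (by linarith)
    rw [show -(1 + 2 * φ₁) = -1 - 2 * φ₁ by ring] at h1
    have h2 : ((n : ℝ) / 2) ^ (-(1 + 2 * m)) = 2 * ((n : ℝ) / 2) ^ (-(2 * m)) / n := by
      rw [show -(1 + 2 * m) = -1 + -(2 * m) by ring, Real.rpow_add (by positivity),
        Real.rpow_neg_one]
      field_simp
    rw [h2] at h1
    have h3 : (0 : ℝ) ≤ ((n : ℝ) / 2) ^ (-(2 * m)) / n := by positivity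
    refine (mul_le_mul_of_nonneg_left h1 (by positivity)).trans ?_
    have h4 := abs_nonneg M₁
    have h5 := abs_nonneg B₀
    rw [mul_div_assoc, mul_div_assoc, ← mul_assoc]
    refine mul_le_mul_of_nonneg_right (by linarith) h3
  · filter_upwards [eventually_card_train hfold hK h.eventually_drift, eventually_gt_atTop 0]
      with n hn hn0 ω i
    have hn' : (0 : ℝ) < n := by exact_mod_cast hn0
    obtain ⟨hk, hN⟩ := hn ω i
    refine hk.trans (ENNReal.ofReal_le_ofReal ?_)
    have h1 := rpow_neg_le_of_le hn0 hN (s := 2 * φ₂) (t := 2 * m) (by linarith) (by linarith)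
    rw [show -(2 * φ₂) = -2 * φ₂ by ring] at h1
    have h3 : (0 : ℝ) ≤ ((n : ℝ) / 2) ^ (-(2 * m)) := by positivity
    refine (mul_le_mul_of_nonneg_left h1 (by positivity)).trans ?_
    have h4 := abs_nonneg M₁
    have h5 := abs_nonneg B₀
    exact mul_le_mul_of_nonneg_right (by linarith) h3
  · filter_upwards [eventually_card_train hfold hK (eventually_gt_atTop 0), hB₀,
      eventually_gt_atTop 0] with n hn hB hn0 i
    have hn' : (0 : ℝ) < n := by exact_mod_cast hn0
    have hpt : ∀ ω, ‖expansionRem W π η₀ (fold n) (L n) (kernelPart F₀ π φ₁ φ₂ δ b)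
        (driftPart F₀ π φ₂ b) i ω‖ₑ ^ 2
        ≤ ENNReal.ofReal ((((n : ℝ) / 2) ^ (-(2 * m))) ^ 2)
          * ‖R n (fold n ω i) ω (π (W i ω))‖ₑ ^ 2 := by
      intro ω
      obtain ⟨hk, hN⟩ := hn ω i
      rw [h.expansionRem_eq ω i hk, enorm_smul_sq (by positivity)]
      gcongr
      have h1 := rpow_neg_le_of_le hn0 hN (s := 2 * m) (t := 2 * m) (by linarith) le_rfl
      rw [← hm, show -2 * m = -(2 * m) by ring]
      exact h1
    refine (lintegral_mono hpt).trans ?_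
    rw [lintegral_const_mul' _ _ ENNReal.ofReal_ne_top]
    refine (mul_le_mul_right (hB i) _).trans ?_
    rw [← ENNReal.ofReal_mul (by positivity)]
    refine ENNReal.ofReal_le_ofReal ?_
    rw [mul_comm]
    refine mul_le_mul_of_nonneg_right ?_ (by positivity)
    linarith [abs_nonneg M₁, le_abs_self B₀]

end Rates

/-! ### Slutsky's lemma and classical limit theorems -/

section Limit

variable {Ω 𝒲 𝒳 : Type*} [MeasurableSpace Ω] [MeasurableSpace 𝒲] [MeasurableSpace 𝒳] {p : ℕ}
  {P : Measure Ω}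

theorem TendstoInMeasure.const_mul_zero {X : ℕ → Ω → ℝ}
    (hX : TendstoInMeasure P X atTop (fun _ => 0)) (a : ℝ) :
    TendstoInMeasure P (fun n ω => a * X n ω) atTop (fun _ => 0) := by
  rw [tendstoInMeasure_iff_norm] at *
  intro ε hε
  rcases eq_or_ne a 0 with rfl | ha
  · simp [hε.not_ge]
  · have ha' : 0 < |a| := abs_pos.2 ha
    refine (hX (ε / |a|) (by positivity)).congr fun n => ?_
    congr 1
    ext ω
    simp [div_le_iff₀ ha', mul_comm]

/-- A sequence of ratios of numerators converging in distribution and denominators converging in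
probability to a non-zero constant. -/
theorem tendstoInDistribution_of_mul_eq [IsProbabilityMeasure P] {Ω' : Type*} [MeasurableSpace Ω']
    {P' : Measure Ω'} [IsProbabilityMeasure P'] {X Y D : ℕ → Ω → ℝ} {Z : Ω' → ℝ} {d : ℝ}
    (hd : d ≠ 0) (hX : TendstoInDistribution X atTop Z (fun _ => P) P')
    (hD : TendstoInMeasure P D atTop (fun _ => d)) (hDm : ∀ n, AEMeasurable (D n) P)
    (hYm : ∀ n, AEMeasurable (Y n) P)
    (hY : ∀ᶠ n in atTop, ∀ ω, D n ω ≠ 0 → Y n ω = X n ω * d / D n ω) :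
    TendstoInDistribution Y atTop Z (fun _ => P) P' := by
  have hd2 : 0 < d ^ 2 / 4 := by positivity
  have hmax : ∀ y : ℝ, max (y ^ 2) (d ^ 2 / 4) ≠ 0 := fun y => (lt_max_of_lt_right hd2).ne'
  -- A continuous substitute for `x * d / y`: the two agree when `|y| ≥ |d| / 2`, and truncating the
  -- denominator removes the singularity at `0`. The discrepancy is then confined to the event `|D n
  -- - d| ≥ |d| / 2`, of vanishing probability.
  let g : ℝ × ℝ → ℝ := fun z => z.1 * (d * z.2 / max (z.2 ^ 2) (d ^ 2 / 4))
  have hg : Continuous g := continuous_fst.mul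
    ((continuous_const.mul continuous_snd).div (by fun_prop) fun z => hmax z.2)
  have h1 := hX.continuous_comp_prodMk_of_tendstoInMeasure_const hg hD hDm
  have h2 : (fun ω => g (Z ω, d)) = Z := by
    ext ω
    have : max (d ^ 2) (d ^ 2 / 4) = d ^ 2 := max_eq_left (by nlinarith)
    simp only [g, this]
    field_simp
  rw [h2] at h1
  refine tendstoInDistribution_of_tendstoInMeasure_sub Y Z h1 ?_ hYm
  rw [tendstoInMeasure_iff_norm] at hD ⊢
  intro ε hε
  refine tendsto_of_tendsto_of_tendsto_of_le_of_le' tendsto_const_nhds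
    (hD (|d| / 2) (by positivity)) (Eventually.of_forall fun _ => zero_le) ?_
  filter_upwards [hY] with n hn
  refine measure_mono fun ω hω => ?_
  by_contra hcon
  have hcon' : ¬ |d| / 2 ≤ |D n ω - d| := hcon
  have h3 : |d| / 2 < |D n ω| := by
    have := abs_sub_abs_le_abs_sub d (D n ω)
    rw [abs_sub_comm] at this
    linarith
  have h4 : d ^ 2 / 4 ≤ D n ω ^ 2 := by
    rw [← sq_abs d, ← sq_abs (D n ω)]
    nlinarith [abs_nonneg d]
  have h5 : D n ω ≠ 0 := by
    rintro h
    rw [h, abs_zero] at h3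
    linarith [abs_nonneg d]
  have h6 : Y n ω - g (X n ω, D n ω) = 0 := by
    rw [hn ω h5]
    simp only [g, max_eq_left h4]
    field_simp
    ring
  have h7 : ε ≤ ‖Y n ω - g (X n ω, D n ω) - 0‖ := hω
  rw [h6] at h7
  simp at h7
  linarith

variable [IsProbabilityMeasure P] {F₀ : Measure 𝒲} [IsProbabilityMeasure F₀] {W : ℕ → Ω → 𝒲}

omit [IsProbabilityMeasure F₀] in
theorem tendstoInMeasure_sample_mean (hW : ∀ i, Measurable (W i)) (hlaw : ∀ i, P.map (W i) = F₀)
    (hind : iIndepFun W P) {u : 𝒲 → ℝ} (hu : Measurable u) (hi : Integrable u F₀) :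
    TendstoInMeasure P (fun n ω => (∑ i ∈ Finset.range n, u (W i ω)) / n - ∫ w, u w ∂F₀) atTop
      (fun _ => 0) := by
  have hident : ∀ i, IdentDistrib (fun ω => u (W i ω)) (fun ω => u (W 0 ω)) P P := fun i =>
    IdentDistrib.comp (u := u) ⟨(hW i).aemeasurable, (hW 0).aemeasurable, by rw [hlaw, hlaw]⟩ hu
  have hi0 : Integrable (fun ω => u (W 0 ω)) P :=
    Integrable.comp_measurable (g := u) (by rwa [hlaw]) (hW 0)
  have h := strong_law_ae_real (fun i ω => u (W i ω)) hi0
    (fun i j hij => (hind.indepFun hij).comp hu hu) hident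
  have hint : ∫ ω, u (W 0 ω) ∂P = ∫ w, u w ∂F₀ := by
    rw [← hlaw 0, integral_map (hW 0).aemeasurable hu.aestronglyMeasurable]
  refine tendstoInMeasure_of_tendsto_ae (fun n => Measurable.aestronglyMeasurable
    (by have := fun i => hu.comp (hW i)
        exact ((Finset.measurable_fun_sum _ fun i _ => this i).div_const _).sub_const _)) ?_
  filter_upwards [h] with ω hω
  rw [hint] at hω
  simpa using hω.sub_const (∫ w, u w ∂F₀)

omit [IsProbabilityMeasure F₀] in
theorem tendstoInDistribution_sample_sum (hW : ∀ i, Measurable (W i))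
    (hlaw : ∀ i, P.map (W i) = F₀) (hind : iIndepFun W P) {u : 𝒲 → ℝ} (hu : Measurable u)
    (hi : MemLp u 2 F₀) (h0 : ∫ w, u w ∂F₀ = 0) :
    TendstoInDistribution (fun (n : ℕ) ω => (√(n : ℝ))⁻¹ * ∑ i ∈ Finset.range n, u (W i ω)) atTop
      (id : ℝ → ℝ) (fun _ => P) (gaussianReal 0 (∫ w, u w ^ 2 ∂F₀).toNNReal) := by
  have hident : ∀ i, IdentDistrib (fun ω => u (W i ω)) (fun ω => u (W 0 ω)) P P := fun i =>
    IdentDistrib.comp (u := u) ⟨(hW i).aemeasurable, (hW 0).aemeasurable, by rw [hlaw, hlaw]⟩ hu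
  have hi0 : MemLp (fun ω => u (W 0 ω)) 2 P :=
    MemLp.comp_of_map (g := u) (by rwa [hlaw]) (hW 0).aemeasurable
  have hint : ∫ ω, u (W 0 ω) ∂P = 0 := by
    rw [← h0, ← hlaw 0, integral_map (hW 0).aemeasurable hu.aestronglyMeasurable]
  have hvar : Var[fun ω => u (W 0 ω); P] = ∫ w, u w ^ 2 ∂F₀ := by
    rw [variance_of_integral_eq_zero (X := fun ω => u (W 0 ω)) (hu.comp (hW 0)).aemeasurable hint, ← hlaw 0,
      integral_map (hW 0).aemeasurable (hu.pow_const 2).aestronglyMeasurable]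
  have hind' : iIndepFun (fun i ω => u (W i ω)) P := hind.comp (fun _ => u) fun _ => hu
  have h := tendstoInDistribution_inv_sqrt_mul_sum_sub
    (P' := gaussianReal 0 (∫ w, u w ^ 2 ∂F₀).toNNReal) (Y := id)
    (X := fun i ω => u (W i ω)) ⟨aemeasurable_id, by rw [Measure.map_id, hvar]⟩ hi0 hind' hident
  simpa [hint] using h

end Limit

/-! ### Measurability and moments of the evaluated score -/

section Score

variable {Ω 𝒲 𝒳 : Type*} [MeasurableSpace Ω] [MeasurableSpace 𝒲] [MeasurableSpace 𝒳] {p : ℕ}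
  {P : Measure Ω} {F₀ : Measure 𝒲} {W : ℕ → Ω → 𝒲} {π : 𝒲 → 𝒳}
  {𝒯 : Set (EuclideanSpace ℝ (Fin p))} {η₀ : 𝒳 → EuclideanSpace ℝ (Fin p)} {M C₁ C₂ C₃ : ℝ}
  {ψ : 𝒲 → EuclideanSpace ℝ (Fin p) → ℝ}

theorem RegularScore.measurable_comp (h : RegularScore F₀ π 𝒯 η₀ M C₁ C₂ C₃ ψ)
    (hπ : Measurable π) (hη₀ : Measurable η₀) (hη₀_mem : ∀ x, η₀ x ∈ 𝒯) :
    Measurable (fun w => ψ w (η₀ (π w))) :=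
  h.measurable.comp (measurable_id.prodMk
    ((hη₀.comp hπ).subtype_mk (h := fun w => hη₀_mem (π w))))

theorem RegularScore.memLp_comp [IsProbabilityMeasure F₀]
    (h : RegularScore F₀ π 𝒯 η₀ M C₁ C₂ C₃ ψ)
    (hπ : Measurable π) (hη₀ : Measurable η₀) (hη₀_mem : ∀ x, η₀ x ∈ 𝒯) :
    MemLp (fun w => ψ w (η₀ (π w))) 2 F₀ :=
  memLp_two_of_lintegral_pow_four_lt_top (h.measurable_comp hπ hη₀ hη₀_mem).aestronglyMeasurable
    (h.fourth_moment.trans ENNReal.ofReal_lt_top)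

theorem RegularScore.measurable_etaHatObs (h : RegularScore F₀ π 𝒯 η₀ M C₁ C₂ C₃ ψ)
    (hW : ∀ i, Measurable (W i)) (hπ : Measurable π) {n K : ℕ} {fold : Ω → Fin n → Fin K}
    (hf : IsRandomSplit P W n K fold) {L : Learner 𝒲 𝒳 p n}
    (hL : ∀ S : Finset (Fin n), Measurable (fun d : (S → 𝒲) × 𝒳 => L S d.1 d.2))
    (hL_mem : ∀ S d x, L S d x ∈ 𝒯) (i : Fin n) :
    Measurable (fun ω => ψ (W i ω) (etaHatObs W π fold L i ω)) :=
  h.measurable.comp ((hW i).prodMk ((DML.measurable_etaHatObs hW hπ hf hL i).subtype_mk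
    (h := fun _ => hL_mem _ _ _)))

end Score

end DML

/-! ### Asymptotic normality of the estimator -/

theorem mainTheorem2
    {Ω 𝒲 𝒳 : Type*} [MeasurableSpace Ω] [MeasurableSpace 𝒲] [MeasurableSpace 𝒳] {p : ℕ}
    (P : Measure Ω) [IsProbabilityMeasure P] (F₀ : Measure 𝒲) [IsProbabilityMeasure F₀]
    -- the random sample and the covariates `X i = π (W i)`
    (W : ℕ → Ω → 𝒲) (hW : ∀ i, Measurable (W i)) (hW_law : ∀ i, P.map (W i) = F₀)
    (hW_indep : iIndepFun W P) (π : 𝒲 → 𝒳) (hπ : Measurable π)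
    -- the nuisance parameter, the moment function and the parameter of interest
    (𝒯 : Set (EuclideanSpace ℝ (Fin p))) (h𝒯 : Convex ℝ 𝒯) (h𝒯_int : (interior 𝒯).Nonempty)
    (η₀ : 𝒳 → EuclideanSpace ℝ (Fin p)) (hη₀ : Measurable η₀) (hη₀_mem : ∀ x, η₀ x ∈ 𝒯)
    (ψa ψb : 𝒲 → EuclideanSpace ℝ (Fin p) → ℝ) (θ₀ : ℝ)
    (hθ₀ : ∫ w, DML.moment ψa ψb w θ₀ (η₀ (π w)) ∂F₀ = 0)
    (M C₀ C₁ C₂ C₃ : ℝ) (hψ : DML.MomentAssumption F₀ π 𝒯 η₀ M C₀ C₁ C₂ C₃ ψa ψb)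
    -- the number of folds, the random splits and the nuisance estimators
    (K : ℕ → ℕ) (hK_le : ∀ n, K n ≤ n) (hK : Tendsto K atTop atTop)
    (fold : (n : ℕ) → Ω → Fin n → Fin (K n))
    (hfold : ∀ n, DML.IsRandomSplit P W n (K n) (fold n))
    (L : (n : ℕ) → DML.Learner 𝒲 𝒳 p n)
    (hL : ∀ (n : ℕ) (S : Finset (Fin n)), Measurable (fun d : (S → 𝒲) × 𝒳 => L n S d.1 d.2))
    (hL_mem : ∀ n S d x, L n S d x ∈ 𝒯)
    (φ₁ φ₂ M₁ Cδ Cb : ℝ) (τ : ℕ → ℝ)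
    (δ : ℕ → 𝒲 → 𝒳 → EuclideanSpace ℝ (Fin p)) (b : ℕ → 𝒳 → 𝒳 → EuclideanSpace ℝ (Fin p))
    (R : (n : ℕ) → Fin (K n) → Ω → 𝒳 → EuclideanSpace ℝ (Fin p))
    (hη : DML.NuisanceAssumption P F₀ W π η₀ K fold L φ₁ φ₂ M₁ Cδ Cb τ δ b R)
    (hφ₁ : φ₁ ≤ 1 / 2) (hφ : 1 / 4 < min φ₁ φ₂) :
    TendstoInDistribution
      (fun (n : ℕ) ω => √(n : ℝ) * (DML.thetaDML2 W π (fold n) (L n) ψa ψb ω - θ₀))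
      atTop (id : ℝ → ℝ) (fun _ => P)
      (gaussianReal 0 (((∫ w, DML.moment ψa ψb w θ₀ (η₀ (π w)) ^ 2 ∂F₀) /
        (∫ w, ψa w (η₀ (π w)) ∂F₀) ^ 2).toNNReal)) := by
  obtain ⟨B, hexp⟩ := hη.exists_crossFitExpansion hπ hfold hK hφ
  have hTa := hexp.tendsto_score_sub hW hW_law hW_indep hπ h𝒯 h𝒯_int hη₀ hη₀_mem hfold hL hL_mem
    hψ.regular_a
  have hTb := hexp.tendsto_score_sub hW hW_law hW_indep hπ h𝒯 h𝒯_int hη₀ hη₀_mem hfold hL hL_mem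
    hψ.regular_b
  have hma := hψ.regular_a.measurable_comp hπ hη₀ hη₀_mem
  have hmb := hψ.regular_b.measurable_comp hπ hη₀ hη₀_mem
  have hLa := hψ.regular_a.memLp_comp hπ hη₀ hη₀_mem
  have hLb := hψ.regular_b.memLp_comp hπ hη₀ hη₀_mem
  have hsa : ∀ n, Measurable (fun ω => ∑ i : Fin n,
      ψa (W i ω) (DML.etaHatObs W π (fold n) (L n) i ω)) := fun n =>
    Finset.measurable_fun_sum _ fun i _ =>
      hψ.regular_a.measurable_etaHatObs hW hπ (hfold n) (hL n) (hL_mem n) i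
  have hsb : ∀ n, Measurable (fun ω => ∑ i : Fin n,
      ψb (W i ω) (DML.etaHatObs W π (fold n) (L n) i ω)) := fun n =>
    Finset.measurable_fun_sum _ fun i _ =>
      hψ.regular_b.measurable_etaHatObs hW hπ (hfold n) (hL n) (hL_mem n) i
  set d : ℝ := ∫ w, ψa w (η₀ (π w)) ∂F₀ with hd_def
  have hd : d ≠ 0 := abs_pos.1 (hψ.C₀_pos.trans hψ.identification)
  -- The influence function of the estimator; its second moment is the limiting variance.
  let u : 𝒲 → ℝ := fun w => DML.moment ψa ψb w θ₀ (η₀ (π w)) / d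
  have hu : Measurable u := (hmb.sub (hma.mul_const θ₀)).div_const d
  have hu2 : MemLp u 2 F₀ := by
    have h1 : MemLp (fun w => d⁻¹ * (ψb w (η₀ (π w)) - θ₀ * ψa w (η₀ (π w)))) 2 F₀ :=
      (hLb.sub (hLa.const_mul θ₀)).const_mul d⁻¹
    refine h1.ae_eq (ae_of_all _ fun w => ?_)
    simp only [u, DML.moment]
    ring
  have hu0 : ∫ w, u w ∂F₀ = 0 := by
    simp only [u]
    rw [integral_div, hθ₀, zero_div]
  have hvar : ∫ w, u w ^ 2 ∂F₀ = (∫ w, DML.moment ψa ψb w θ₀ (η₀ (π w)) ^ 2 ∂F₀) / d ^ 2 := by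
    simp only [u, div_pow]
    rw [integral_div]
  have hclt := DML.tendstoInDistribution_sample_sum hW hW_law hW_indep hu hu2 hu0
  rw [hvar] at hclt
  -- the numerator with the estimated nuisance parameter
  let X : ℕ → Ω → ℝ := fun n ω => (√(n : ℝ))⁻¹ *
    ((∑ i : Fin n, ψb (W i ω) (DML.etaHatObs W π (fold n) (L n) i ω)) -
      θ₀ * ∑ i : Fin n, ψa (W i ω) (DML.etaHatObs W π (fold n) (L n) i ω)) / d
  have hXm : ∀ n, Measurable (X n) := fun n =>
    (((hsb n).sub ((hsa n).const_mul θ₀)).const_mul _).div_const d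
  have hX : TendstoInDistribution X atTop (id : ℝ → ℝ) (fun _ => P)
      (gaussianReal 0 (((∫ w, DML.moment ψa ψb w θ₀ (η₀ (π w)) ^ 2 ∂F₀) / d ^ 2).toNNReal)) := by
    refine tendstoInDistribution_of_tendstoInMeasure_sub X id hclt ?_
      fun n => (hXm n).aemeasurable
    refine DML.tendstoInMeasure_zero_of_abs_le (Eventually.of_forall fun n => ae_of_all _ fun ω => ?_)
      (DML.TendstoInMeasure.const_mul_zero hTb d⁻¹)
      (DML.TendstoInMeasure.const_mul_zero hTa (-(θ₀ * d⁻¹)))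
      -- A zero sequence filling the third slot of the domination lemma.
      (DML.TendstoInMeasure.const_mul_zero hTa 0)
    have hcongr : (X - fun (n : ℕ) ω => (√(n : ℝ))⁻¹ * ∑ i ∈ Finset.range n, u (W i ω)) n ω
        = d⁻¹ * ((√(n : ℝ))⁻¹ * ∑ i : Fin n, (ψb (W i ω)
            (DML.etaHatObs W π (fold n) (L n) i ω) - ψb (W i ω) (η₀ (π (W i ω)))))
          + -(θ₀ * d⁻¹) * ((√(n : ℝ))⁻¹ * ∑ i : Fin n, (ψa (W i ω)
            (DML.etaHatObs W π (fold n) (L n) i ω) - ψa (W i ω) (η₀ (π (W i ω))))) := by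
      simp only [Pi.sub_apply, X, u, DML.moment]
      rw [Finset.sum_range, ← Finset.sum_div, Finset.sum_sub_distrib, Finset.sum_sub_distrib,
        Finset.sum_sub_distrib, ← Finset.sum_mul]
      ring
    rw [hcongr]
    exact (abs_add_le _ _).trans (le_add_of_nonneg_right (abs_nonneg _))
  have hD : TendstoInMeasure P (fun (n : ℕ) ω => (n : ℝ)⁻¹ *
      ∑ i : Fin n, ψa (W i ω) (DML.etaHatObs W π (fold n) (L n) i ω)) atTop (fun _ => d) := by
    have h1 : TendstoInMeasure P (fun (n : ℕ) ω => (n : ℝ)⁻¹ *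
        ∑ i : Fin n, ψa (W i ω) (DML.etaHatObs W π (fold n) (L n) i ω) - d) atTop
        (fun _ => 0) := by
      -- The denominator differs from the oracle sample mean by `T / √n`, where `T` is already
      -- negligible.
      refine DML.tendstoInMeasure_zero_of_abs_le ?_
        (DML.tendstoInMeasure_sample_mean hW hW_law hW_indep hma (hLa.integrable (by norm_num)))
        hTa (DML.TendstoInMeasure.const_mul_zero hTa 0)
      filter_upwards [eventually_gt_atTop 0] with n hn
      refine ae_of_all _ fun ω => ?_
      have hn' : (1 : ℝ) ≤ n := by exact_mod_cast hn
      have hs : 1 ≤ √(n : ℝ) := Real.one_le_sqrt.2 hn'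
      set T := (√(n : ℝ))⁻¹ * ∑ i : Fin n, (ψa (W i ω)
        (DML.etaHatObs W π (fold n) (L n) i ω) - ψa (W i ω) (η₀ (π (W i ω)))) with hT
      have h2 : (n : ℝ)⁻¹ * ∑ i : Fin n, ψa (W i ω) (DML.etaHatObs W π (fold n) (L n) i ω) - d
          = ((∑ i ∈ Finset.range n, ψa (W i ω) (η₀ (π (W i ω)))) / n - d)
            + (√(n : ℝ))⁻¹ * T := by
        rw [hT, ← mul_assoc, ← mul_inv, Real.mul_self_sqrt (by positivity), Finset.sum_range,
          Finset.sum_sub_distrib]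
        ring
      have h3 : |(√(n : ℝ))⁻¹ * T| ≤ |T| := by
        rw [abs_mul, abs_of_nonneg (by positivity : 0 ≤ (√(n : ℝ))⁻¹)]
        exact mul_le_of_le_one_left (abs_nonneg _) (inv_le_one_of_one_le₀ hs)
      rw [h2]
      refine (abs_add_le _ _).trans ((add_le_add le_rfl h3).trans
        (le_add_of_nonneg_right (abs_nonneg _)))
    rw [tendstoInMeasure_iff_norm] at h1 ⊢
    simpa using h1
  have hDm : ∀ n : ℕ, Measurable (fun ω => (n : ℝ)⁻¹ *
      ∑ i : Fin n, ψa (W i ω) (DML.etaHatObs W π (fold n) (L n) i ω)) := fun n =>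
    (hsa n).const_mul _
  -- By linearity of the moment in `θ`, the normalized error equals `X * d` over the sample
  -- denominator exactly, whenever that denominator is nonzero.
  refine DML.tendstoInDistribution_of_mul_eq hd hX hD (fun n => (hDm n).aemeasurable)
    (fun n => (((((hsb n).const_mul _).div (hDm n)).sub_const θ₀).const_mul _).aemeasurable) ?_
  filter_upwards [eventually_gt_atTop 0] with n hn ω hω
  have hn' : (0 : ℝ) < n := by exact_mod_cast hn
  have hs : √(n : ℝ) * (n : ℝ)⁻¹ = (√(n : ℝ))⁻¹ := by
    rw [← div_eq_mul_inv, Real.sqrt_div_self', one_div]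
  simp only [X, DML.thetaDML2]
  rw [div_mul_cancel₀ _ hd, ← hs, eq_div_iff hω, mul_assoc, sub_mul, div_mul_cancel₀ _ hω]
  ring
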